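/- For $\omega<1$ and $-1<\phi<1$ let $$V(\phi)=\tfrac12(\omega-\phi^2)+\tfrac12(1-\omega)\log\frac{1-\omega}{1-\phi^2},\qquad E(\phi,\phi')=\tfrac12(\phi')^2+V(\phi),\qquad \mathcal E_\omega=V(0)=\tfrac12\omega+\tfrac12(1-\omega)\log(1-\omega),$$ where $E$ is the conserved energy of Newton's equation $\phi''=-V'(\phi)=\frac{(\omega-\phi^2)\phi}{1-\phi^2}$. The period function is $$T(\mathcal E,\omega)=\oint\frac{d\phi}{\sqrt{2(\mathcal E-V(\phi))}}=2\int_m^M\frac{d\phi}{\sqrt{2(\mathcal E-V(\phi))}},$$ the line integral along the closed orbit of energy $\mathcal E$, on which $\phi$ ranges over $[m,M]$. For $\omega\in(0,1)$ and $\mathcal E\in(0,\mathcal E_\omega)$ this is the orbit of energy $\mathcal E$ in the half-plane $\phi>0$ (even waves, inside the homoclinic orbit; $0<m<M<1$ are the roots of $V=\mathcal E$ in $(0,1)$). For $\omega<1$ and $\mathcal E>\mathcal E_\omega$ it is the whole level curve $E=\mathcal E$ in the strip $|\phi|<1$ (odd waves; $m=-M$, where $M$ is the root of $V=\mathcal E$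 in $(0,1)$). Theorem. In all these cases the integral converges. If $\omega\in(0,1)$, then $\mathcal E\mapsto T(\mathcal E,\omega)$ is $C^1$ on $(0,\infty)\setminus\{\mathcal E_\omega\}$; if $\omega\in(-\infty,0)$, then it is $C^1$ on $(\mathcal E_\omega,\infty)$. For every $\omega\in(0,1)$ the map $\mathcal E\mapsto T(\mathcal E,\omega)$ is strictly increasing on $(0,\mathcal E_\omega)$. For every $\omega\in(-\infty,1)$ it is strictly decreasing on $(\mathcal E_\omega,\infty)$. -/

import Mathlib

noncomputable section

namespace NLSIDD

/-- The potential energy `V` of Newton's equation `φ'' = -V'(φ)`, used for `ω < 1`, `-1 < φ < 1`. -/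
def potential (ω φ : ℝ) : ℝ :=
  (1 / 2) * (ω - φ ^ 2) + (1 / 2) * (1 - ω) * Real.log ((1 - ω) / (1 - φ ^ 2))

/-- The conserved energy `E(φ, ξ) = ξ² / 2 + V(φ)`, where `ξ = φ'`. -/
def energy (ω φ ξ : ℝ) : ℝ :=
  (1 / 2) * ξ ^ 2 + potential ω φ

/-- The energy level of the equilibrium `(0, 0)`: the homoclinic level if `0 < ω < 1`,
the level of the center if `ω ≤ 0`. -/
def criticalEnergy (ω : ℝ) : ℝ :=
  energy ω 0 0

/-- The periodic orbit of energy `𝓔` in the phase plane. For `0 < ω < 1` and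
`0 < 𝓔 < criticalEnergy ω` the level curve consists of two closed orbits, exchanged by
`φ ↦ -φ`; the one in the half-plane `φ > 0` (the even wave) is taken. For
`𝓔 > criticalEnergy ω` it is the whole level curve in the strip `-1 < φ < 1` (the odd wave). -/
def periodicOrbit (ω 𝓔 : ℝ) : Set (ℝ × ℝ) :=
  {p | -1 < p.1 ∧ p.1 < 1 ∧ energy ω p.1 p.2 = 𝓔 ∧ (𝓔 < criticalEnergy ω → 0 < p.1)}

/-- The range `[m, M]` of `φ` along the periodic orbit: its projection to the `φ`-axis. -/
def orbitRange (ω 𝓔 : ℝ) : Set ℝ :=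
  Prod.fst '' periodicOrbit ω 𝓔

/-- The integrand `1 / √(2 (𝓔 - V(φ)))` of the period function. -/
def periodIntegrand (ω 𝓔 φ : ℝ) : ℝ :=
  1 / Real.sqrt (2 * (𝓔 - potential ω φ))

/-- The period function `T(𝓔, ω) = ∮ dφ / √(2 (𝓔 - V(φ)))`, the line integral of `dφ / φ'` along
the closed orbit. The orbit consists of the two branches `φ' = ± √(2 (𝓔 - V(φ)))` over
`orbitRange ω 𝓔`, traversed in opposite directions, and each contributes the same integral. -/
def period (𝓔 ω : ℝ) : ℝ :=
  2 * ∫ φ in orbitRange ω 𝓔, periodIntegrand ω 𝓔 φ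

end NLSIDD

end

open MeasureTheory Set Filter Topology

namespace NLSIDD

/-! Put a = 1 - ω and x = (1 - φ²)/a. Then V = (a/2) `logGap` x with `logGap` x = x - 1 - log x,
which is convex with minimum 0 at x = 1.

Even waves, energy (a/2)k: the center x = 1 cuts the orbit's range into two arcs, and on each x is a
branch of the inverse of `logGap`. Taking the rescaled potential k u, 0 < u < 1, as the variable
gives T = √a ∫ (D₊(ku) - D₋(ku)) / √(u(1-u)) du, where D₊, D₋ are `density` along the upper and
lower branch. The interval no longer depends on the energy, so it suffices that D₊ - D₋ increases.
Here √k D±'(k) = `densitySlope` a x depends on k only through x, and `densitySlope_lt_of_lt_of_gt`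
separates its values for x < 1 from those for x > 1 by its limit at x = 1. This rests on the
elementary inequalities `logGap_sub_sign` and `sq_sub_two_mul_logGap_gt`.

Odd waves, squared amplitude s: scaling φ = √s t gives T = 2 ∫ dt / √(`oddDrop` a s t²) over (-1,
1). For fixed t the function `oddDrop` is strictly increasing in s (`strictMonoOn_oddDrop`), and s
increases with the energy, so T decreases.

Convergence and C¹ regularity come from dominating the integrands and their parameter derivatives by
multiples of 1/√(u(1-u)) and 1/√(1-t²). -/

/-! ### Parameter integrals, local inverses and the two integrable weights -/

theorem contDiffOn_one_of_hasDerivAt {U : Set ℝ} (hU : IsOpen U) {f f' : ℝ → ℝ}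
    (hd : ∀ x ∈ U, HasDerivAt f (f' x) x) (hc : ContinuousOn f' U) : ContDiffOn ℝ 1 f U := by
  have key := contDiffOn_succ_iff_deriv_of_isOpen (𝕜 := ℝ) (n := 0) (f := f) hU
  rw [zero_add] at key
  refine key.2 ⟨fun x hx => (hd x hx).differentiableAt.differentiableWithinAt, by simp, ?_⟩
  exact contDiffOn_zero.2 (hc.congr fun x hx => (hd x hx).deriv)

/-- One local bound on the derivative serves twice: for differentiating under the integral sign, and
for continuity of the resulting derivative by dominated convergence. -/
theorem contDiffOn_integral_of_dominated {α : Type*} [MeasurableSpace α] {μ : Measure α}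
    {U : Set ℝ} (hU : IsOpen U) {F F' : ℝ → α → ℝ}
    (hF : ∀ x ∈ U, Integrable (F x) μ)
    (hF' : ∀ x ∈ U, AEStronglyMeasurable (F' x) μ)
    (hd : ∀ᵐ a ∂μ, ∀ x ∈ U, HasDerivAt (fun y => F y a) (F' x a) x)
    (hc : ∀ᵐ a ∂μ, ∀ x ∈ U, ContinuousAt (fun y => F' y a) x)
    (hb : ∀ x₀ ∈ U, ∃ bound : α → ℝ, Integrable bound μ ∧
      ∃ s ∈ 𝓝 x₀, ∀ᵐ a ∂μ, ∀ x ∈ s, |F' x a| ≤ bound a) :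
    ContDiffOn ℝ 1 (fun x => ∫ a, F x a ∂μ) U := by
  have hder : ∀ x ∈ U, HasDerivAt (fun x => ∫ a, F x a ∂μ) (∫ a, F' x a ∂μ) x := by
    intro x₀ hx₀
    obtain ⟨bound, hbi, s, hs, hbs⟩ := hb x₀ hx₀
    have hsU : s ∩ U ∈ 𝓝 x₀ := inter_mem hs (hU.mem_nhds hx₀)
    refine (hasDerivAt_integral_of_dominated_loc_of_deriv_le (F := F) (F' := F') hsU ?_
      (hF x₀ hx₀) (hF' x₀ hx₀) ?_ hbi ?_).2
    · filter_upwards [hU.mem_nhds hx₀] with x hx using (hF x hx).aestronglyMeasurable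
    · filter_upwards [hbs] with a ha x hx using ha x hx.1
    · filter_upwards [hd] with a ha x hx using ha x hx.2
  refine contDiffOn_one_of_hasDerivAt hU hder fun x₀ hx₀ => ContinuousAt.continuousWithinAt ?_
  obtain ⟨bound, hbi, s, hs, hbs⟩ := hb x₀ hx₀
  refine continuousAt_of_dominated (bound := bound) ?_ ?_ hbi ?_
  · filter_upwards [hU.mem_nhds hx₀] with x hx using hF' x hx
  · filter_upwards [hs] with x hx
    filter_upwards [hbs] with a ha using ha x hx
  · filter_upwards [hc] with a ha using ha x₀ hx₀

theorem setIntegral_Ioo_lt {a b : ℝ} (hab : a < b) {f g : ℝ → ℝ}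
    (hf : IntegrableOn f (Ioo a b)) (hg : IntegrableOn g (Ioo a b))
    (h : ∀ x ∈ Ioo a b, f x < g x) : ∫ x in Ioo a b, f x < ∫ x in Ioo a b, g x := by
  have hpos : 0 < ∫ x in Ioo a b, (g x - f x) := by
    rw [setIntegral_pos_iff_support_of_nonneg_ae]
    · have : Function.support (fun x => g x - f x) ∩ Ioo a b = Ioo a b := by
        refine inter_eq_right.2 fun x hx => ?_
        have := h x hx
        simp only [Function.mem_support]
        linarith
      rw [this, Real.volume_Ioo]
      simpa using hab
    · filter_upwards [ae_restrict_mem measurableSet_Ioo] with x hx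
      have := h x hx
      simp only [Pi.zero_apply]
      linarith
    · exact hg.sub hf
  rw [integral_sub hg hf] at hpos
  linarith

/-- Injectivity on an open set makes the chosen inverse a left inverse near x, so the inverse
function theorem applies to it. It serves for both branches of `logGap` and for the amplitude of the
odd waves. -/
theorem hasStrictDerivAt_invFunOn {f : ℝ → ℝ} {f' x : ℝ} {s : Set ℝ} (hs : IsOpen s)
    (hinj : InjOn f s) (hx : x ∈ s) (hf : HasStrictDerivAt f f' x) (hf' : f' ≠ 0) :
    HasStrictDerivAt (Function.invFunOn f s) f'⁻¹ (f x) := by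
  refine hf.to_local_left_inverse hf' ?_
  filter_upwards [hs.mem_nhds hx] with y hy using hinj.leftInvOn_invFunOn hy

theorem integrableOn_one_div_sqrt_mul_one_sub :
    IntegrableOn (fun u : ℝ => 1 / √(u * (1 - u))) (Ioo 0 1) := by
  have h0 : IntegrableOn (fun u : ℝ => u ^ (-(1 / 2) : ℝ)) (Ioo 0 1) :=
    (intervalIntegral.integrableOn_Ioo_rpow_iff one_pos).2 (by norm_num)
  have h1 : IntegrableOn (fun u : ℝ => (1 - u) ^ (-(1 / 2) : ℝ)) (Ioo 0 1) := by
    have : (fun u : ℝ => 1 - u) '' Ioo 0 1 = Ioo 0 1 := by simp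
    rw [← this] at h0
    rw [integrableOn_image_iff_integrableOn_abs_deriv_smul (f := fun u : ℝ => 1 - u)
      (f' := fun _ => -1) measurableSet_Ioo
      (fun x _ => ((hasDerivAt_id x).const_sub 1).hasDerivWithinAt)
      (fun x _ y _ h => by simpa using h)] at h0
    simpa using h0
  refine Integrable.mono' (h0.add h1)
    (by measurability : Measurable fun u : ℝ => 1 / √(u * (1 - u))).aestronglyMeasurable ?_
  filter_upwards [ae_restrict_mem measurableSet_Ioo] with u hu
  obtain ⟨hu0, hu1⟩ := hu
  have hv : 0 < 1 - u := by linarith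
  simp only [Pi.add_apply]
  rw [Real.norm_of_nonneg (by positivity), Real.rpow_neg hu0.le, Real.rpow_neg hv.le,
    ← Real.sqrt_eq_rpow, ← Real.sqrt_eq_rpow, Real.sqrt_mul hu0.le]
  have hp := Real.sqrt_pos.2 hu0
  have hq := Real.sqrt_pos.2 hv
  have h3 : √u ^ 2 = u := Real.sq_sqrt hu0.le
  have h4 : √(1 - u) ^ 2 = 1 - u := Real.sq_sqrt hv.le
  rw [inv_eq_one_div, inv_eq_one_div, div_add_div _ _ hp.ne' hq.ne']
  gcongr
  -- What remains is 1 ≤ √u + √(1-u), true since the square of the right side is 1 + 2√u√(1-u).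
  nlinarith [mul_pos hp hq]

theorem integrableOn_one_div_sqrt_one_sub_sq :
    IntegrableOn (fun t : ℝ => 1 / √(1 - t ^ 2)) (Ioo (-1) 1) := by
  have himg : (fun u : ℝ => 2 * u + -1) '' Ioo 0 1 = Ioo (-1) 1 := by
    rw [image_affine_Ioo two_pos]
    norm_num
  rw [← himg, integrableOn_image_iff_integrableOn_abs_deriv_smul (f' := fun _ => 2)
    measurableSet_Ioo
    (fun x _ => by
      simpa using ((((hasDerivAt_id x).const_mul 2).add_const (-1 : ℝ))).hasDerivWithinAt)
    (fun x _ y _ h => by simpa using h)]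
  refine integrableOn_one_div_sqrt_mul_one_sub.congr_fun (fun u hu => ?_) measurableSet_Ioo
  have h : 1 - (2 * u + -1) ^ 2 = 2 ^ 2 * (u * (1 - u)) := by ring
  have hp : 0 < √(u * (1 - u)) := Real.sqrt_pos.2 (mul_pos hu.1 (by linarith [hu.2]))
  simp only [h, Real.sqrt_mul (sq_nonneg (2 : ℝ)), Real.sqrt_sq zero_le_two, smul_eq_mul,
    abs_two]
  field_simp

/-! ### The function x - 1 - log x and its inequalities -/

/-- The convex function `x ↦ x - 1 - log x`, in terms of which the potential is expressed. -/
noncomputable def logGap (x : ℝ) : ℝ := x - 1 - Real.log x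

theorem potential_eq {ω φ : ℝ} (hω : ω < 1) (h : φ ^ 2 < 1) :
    potential ω φ = (1 - ω) / 2 * logGap ((1 - φ ^ 2) / (1 - ω)) := by
  have h1 : 0 < 1 - ω := by linarith
  have h2 : 0 < 1 - φ ^ 2 := by linarith
  unfold potential logGap
  rw [Real.log_div h1.ne' h2.ne', Real.log_div h2.ne' h1.ne']
  field_simp
  ring

theorem criticalEnergy_eq (ω : ℝ) : criticalEnergy ω = potential ω 0 := by
  simp [criticalEnergy, energy]

theorem hasStrictDerivAt_logGap {x : ℝ} (hx : 0 < x) :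
    HasStrictDerivAt logGap (1 - x⁻¹) x :=
  ((hasStrictDerivAt_id x).sub_const 1).sub (Real.hasStrictDerivAt_log hx.ne')

theorem hasDerivAt_logGap {x : ℝ} (hx : 0 < x) : HasDerivAt logGap (1 - x⁻¹) x :=
  (hasStrictDerivAt_logGap hx).hasDerivAt

theorem continuousOn_logGap : ContinuousOn logGap (Ioi 0) := fun _ hx =>
  (hasDerivAt_logGap hx).continuousAt.continuousWithinAt

@[simp] theorem logGap_one : logGap 1 = 0 := by simp [logGap]

theorem logGap_pos {x : ℝ} (hx : 0 < x) (h1 : x ≠ 1) : 0 < logGap x := by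
  have := Real.log_lt_sub_one_of_pos hx h1
  unfold logGap
  linarith

/-- Follows from log x ≥ 1 - 1/x. Along a branch it reads √k ≤ |x - 1|/√x, which cancels the pole of
`density` at x = 1. -/
theorem logGap_le {x : ℝ} (hx : 0 < x) : logGap x ≤ (x - 1) ^ 2 / x := by
  have := Real.one_sub_inv_le_log_of_pos hx
  have h : (x - 1) ^ 2 / x = x - 1 - (1 - x⁻¹) := by field_simp
  rw [h, logGap]
  linarith

theorem strictMonoOn_logGap : StrictMonoOn logGap (Ici 1) := by
  refine strictMonoOn_of_deriv_pos (convex_Ici 1)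
    (continuousOn_logGap.mono fun x hx => lt_of_lt_of_le one_pos (mem_Ici.1 hx)) fun x hx => ?_
  rw [interior_Ici, mem_Ioi] at hx
  rw [(hasDerivAt_logGap (by linarith)).deriv]
  have := inv_lt_one_of_one_lt₀ hx
  linarith

theorem strictAntiOn_logGap : StrictAntiOn logGap (Ioc 0 1) := by
  refine strictAntiOn_of_deriv_neg (convex_Ioc 0 1)
    (continuousOn_logGap.mono fun x hx => hx.1) fun x hx => ?_
  rw [interior_Ioc] at hx
  rw [(hasDerivAt_logGap hx.1).deriv]
  have := (one_lt_inv₀ hx.1).2 hx.2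
  linarith

theorem exists_logGap_eq_of_one_lt {k : ℝ} (hk : 0 < k) : ∃ x ∈ Ioi (1 : ℝ), logGap x = k := by
  -- The witness 2k + 2 works because log 2 ≤ 1 and log (k + 1) ≤ k.
  have hlog : Real.log (2 * k + 2) ≤ k + 1 := by
    have h2 : Real.log 2 ≤ 2 - 1 := Real.log_le_sub_one_of_pos two_pos
    have h3 := Real.log_le_sub_one_of_pos (show 0 < k + 1 by linarith)
    rw [show 2 * k + 2 = 2 * (k + 1) by ring, Real.log_mul two_ne_zero (by linarith)]
    linarith
  have hle : k ≤ logGap (2 * k + 2) := by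
    unfold logGap
    linarith
  obtain ⟨x, hx, hxk⟩ := intermediate_value_Icc (show (1 : ℝ) ≤ 2 * k + 2 by linarith)
    (continuousOn_logGap.mono fun x hx => lt_of_lt_of_le one_pos hx.1)
    (show k ∈ Icc _ _ from ⟨by rw [logGap_one]; exact hk.le, hle⟩)
  refine ⟨x, lt_of_le_of_ne hx.1 ?_, hxk⟩
  rintro rfl
  rw [logGap_one] at hxk
  exact hk.ne hxk

theorem exists_logGap_eq_of_lt_one {k : ℝ} (hk : 0 < k) :
    ∃ x ∈ Ioo (0 : ℝ) 1, logGap x = k := by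
  -- At x = exp (-(k+1)) the value of `logGap` is exactly x + k.
  have hexp : Real.exp (-(k + 1)) ≤ 1 := Real.exp_le_one_iff.2 (by linarith)
  have hle : k ≤ logGap (Real.exp (-(k + 1))) := by
    unfold logGap
    rw [Real.log_exp]
    linarith [Real.exp_pos (-(k + 1))]
  obtain ⟨x, hx, hxk⟩ := intermediate_value_Icc' hexp
    (continuousOn_logGap.mono fun x hx => lt_of_lt_of_le (Real.exp_pos _) hx.1)
    (show k ∈ Icc _ _ from ⟨by rw [logGap_one]; exact hk.le, hle⟩)
  refine ⟨x, ⟨lt_of_lt_of_le (Real.exp_pos _) hx.1, lt_of_le_of_ne hx.2 ?_⟩, hxk⟩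
  rintro rfl
  rw [logGap_one] at hxk
  exact hk.ne hxk

/-- A function vanishing at `1` whose derivative on `(0, ∞)` has the sign of `x - 1` away
from `1` is positive away from `1`. -/
theorem pos_of_hasDerivAt_sign {f f' : ℝ → ℝ} (h1 : f 1 = 0)
    (hf : ∀ x, 0 < x → HasDerivAt f (f' x) x) (hpos : ∀ x, 1 < x → 0 < f' x)
    (hneg : ∀ x, 0 < x → x < 1 → f' x < 0) {x : ℝ} (hx : 0 < x) (hx1 : x ≠ 1) : 0 < f x := by
  rcases lt_or_gt_of_ne hx1 with h | h
  · have hanti : StrictAntiOn f (Ioc 0 1) := by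
      refine strictAntiOn_of_deriv_neg (convex_Ioc 0 1)
        (fun y hy => (hf y hy.1).continuousAt.continuousWithinAt) fun y hy => ?_
      rw [interior_Ioc] at hy
      rw [(hf y hy.1).deriv]
      exact hneg y hy.1 hy.2
    simpa [h1] using hanti ⟨hx, h.le⟩ ⟨one_pos, le_rfl⟩ h
  · have hmono : StrictMonoOn f (Ici 1) := by
      refine strictMonoOn_of_deriv_pos (convex_Ici 1)
        (fun y hy => (hf y (lt_of_lt_of_le one_pos hy)).continuousAt.continuousWithinAt)
        fun y hy => ?_
      rw [interior_Ici, mem_Ioi] at hy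
      rw [(hf y (by linarith)).deriv]
      exact hpos y hy
    simpa [h1] using hmono (mem_Ici.2 le_rfl) (mem_Ici.2 h.le) h

/-- A function vanishing at `1` whose derivative on `(0, ∞)` is positive away from `1` has the
sign of `x - 1`. -/
theorem sign_of_hasDerivAt_pos {f f' : ℝ → ℝ} (h1 : f 1 = 0)
    (hf : ∀ x, 0 < x → HasDerivAt f (f' x) x) (hpos : ∀ x, 0 < x → x ≠ 1 → 0 < f' x) {x : ℝ}
    (hx : 0 < x) (hx1 : x ≠ 1) : 0 < (x - 1) * f x := by
  have hcont : ∀ y, 0 < y → ContinuousAt f y := fun y hy => (hf y hy).continuousAt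
  rcases lt_or_gt_of_ne hx1 with h | h
  · have hmono : StrictMonoOn f (Ioc 0 1) := by
      refine strictMonoOn_of_deriv_pos (convex_Ioc 0 1)
        (fun y hy => (hcont y hy.1).continuousWithinAt) fun y hy => ?_
      rw [interior_Ioc] at hy
      rw [(hf y hy.1).deriv]
      exact hpos y hy.1 hy.2.ne
    have := hmono ⟨hx, h.le⟩ ⟨one_pos, le_rfl⟩ h
    rw [h1] at this
    exact mul_pos_of_neg_of_neg (by linarith) this
  · have hmono : StrictMonoOn f (Ici 1) := by
      refine strictMonoOn_of_deriv_pos (convex_Ici 1)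
        (fun y hy => (hcont y (lt_of_lt_of_le one_pos hy)).continuousWithinAt) fun y hy => ?_
      rw [interior_Ici, mem_Ioi] at hy
      rw [(hf y (by linarith)).deriv]
      exact hpos y (by linarith) hy.ne'
    have := hmono (mem_Ici.2 le_rfl) (mem_Ici.2 h.le) h
    rw [h1] at this
    exact mul_pos (by linarith) this

/-- The second factor has derivative (x-1)²(x+1)/x³. It decides on which side of its limit 1/2 at x
= 1 the quotient x² `logGap` x / (x-1)² lies. -/
theorem logGap_sub_sign {x : ℝ} (hx : 0 < x) (hx1 : x ≠ 1) :
    0 < (x - 1) * (logGap x - (1 / 2) * (1 - x⁻¹) ^ 2) := by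
  refine sign_of_hasDerivAt_pos (f := fun x => logGap x - (1 / 2) * (1 - x⁻¹) ^ 2)
    (f' := fun x => (x - 1) ^ 2 * (x + 1) / x ^ 3) (by simp) (fun y hy => ?_) (fun y hy hy1 => ?_)
    hx hx1
  · refine ((hasDerivAt_logGap hy).sub
      ((((hasDerivAt_inv hy.ne').const_sub 1).pow 2).const_mul (1 / 2))).congr_deriv ?_
    simp only [Nat.cast_ofNat, Nat.add_one_sub_one, pow_one]
    field_simp
    ring
  · have : 0 < (y - 1) ^ 2 := by
      have := sub_ne_zero.2 hy1
      positivity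
    positivity

/-- The derivative is 2(x-1)³/(3x²), of the sign of x - 1. The term with 2/3 is what remains after
subtracting the limit 1/3 at x = 1 from the first bracket of `densitySlope`. -/
theorem sq_sub_two_mul_logGap_gt {x : ℝ} (hx : 0 < x) (hx1 : x ≠ 1) :
    0 < (x - 1) ^ 2 - 2 * logGap x - 2 / 3 * ((x - 1) ^ 3 / x) := by
  refine pos_of_hasDerivAt_sign
    (f := fun x => (x - 1) ^ 2 - 2 * logGap x - 2 / 3 * ((x - 1) ^ 3 / x))
    (f' := fun x => 2 * (x - 1) ^ 3 / (3 * x ^ 2)) (by simp) (fun y hy => ?_) (fun y hy => ?_)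
    (fun y hy hy1 => ?_) hx hx1
  · have h := (hasDerivAt_id y).sub_const 1
    refine (((h.pow 2).sub ((hasDerivAt_logGap hy).const_mul 2)).sub
      (((h.pow 3).div (hasDerivAt_id y) hy.ne').const_mul (2 / 3))).congr_deriv ?_
    simp only [id, Pi.pow_apply]
    field_simp
    ring
  · have : 0 < y - 1 := by linarith
    positivity
  · have : 0 < 1 - y := by linarith
    have h : 2 * (y - 1) ^ 3 / (3 * y ^ 2) = -(2 * (1 - y) ^ 3 / (3 * y ^ 2)) := by ring
    rw [h, neg_lt_zero]
    positivity

/-! ### Integrals of R(ku) against 1/√(u(1-u)) -/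

section ScaledIntegral

variable {R R' : ℝ → ℝ} {K : ℝ}

theorem integrableOn_scaled_div_sqrt
    (hR : ContinuousOn R (Ioo 0 K))
    (hb : ∀ k ∈ Ioo 0 K, ∃ B, ∀ x ∈ Ioc 0 k, |R x| ≤ B) {k : ℝ} (hk : k ∈ Ioo 0 K) :
    IntegrableOn (fun u => R (k * u) * (1 / √(u * (1 - u)))) (Ioo 0 1) := by
  obtain ⟨B, hB⟩ := hb k hk
  refine (integrableOn_one_div_sqrt_mul_one_sub.integrable.bdd_mul (c := B) ?_ ?_)
  · refine ContinuousOn.aestronglyMeasurable (hR.comp (by fun_prop) fun u hu => ?_)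
      measurableSet_Ioo
    exact ⟨mul_pos hk.1 hu.1, by nlinarith [hk.1, hk.2, hu.2]⟩
  · filter_upwards [ae_restrict_mem measurableSet_Ioo] with u hu
    exact hB _ ⟨mul_pos hk.1 hu.1, by nlinarith [hk.1, hk.2, hu.2]⟩

/-- The k-derivative of R(ku) is u R'(ku) = (ku) R'(ku) / k, so a bound on x R'(x) suffices and R'
itself may blow up at 0. -/
theorem contDiffOn_integral_scaled_div_sqrt
    (hd : ∀ k ∈ Ioo 0 K, HasDerivAt R (R' k) k) (hc : ContinuousOn R' (Ioo 0 K))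
    (hb : ∀ k ∈ Ioo 0 K, ∃ B, ∀ x ∈ Ioc 0 k, |R x| ≤ B)
    (hb' : ∀ k ∈ Ioo 0 K, ∃ B, ∀ x ∈ Ioc 0 k, |x * R' x| ≤ B) :
    ContDiffOn ℝ 1 (fun k => ∫ u in Ioo 0 1, R (k * u) * (1 / √(u * (1 - u)))) (Ioo 0 K) := by
  have hmem : ∀ k ∈ Ioo 0 K, ∀ u ∈ Ioo (0 : ℝ) 1, k * u ∈ Ioo 0 K := fun k hk u hu =>
    ⟨mul_pos hk.1 hu.1, by nlinarith [hk.1, hk.2, hu.2]⟩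
  refine contDiffOn_integral_of_dominated (F' := fun k u => R' (k * u) * u * (1 / √(u * (1 - u))))
    isOpen_Ioo
    (fun k hk => integrableOn_scaled_div_sqrt
      (fun x hx => (hd x hx).continuousAt.continuousWithinAt) hb hk) ?_ ?_ ?_ ?_
  · intro k hk
    refine (ContinuousOn.aestronglyMeasurable (((hc.comp (by fun_prop) (hmem k hk))).mul
      continuousOn_id) measurableSet_Ioo).mul ?_
    exact integrableOn_one_div_sqrt_mul_one_sub.aestronglyMeasurable
  · filter_upwards [ae_restrict_mem measurableSet_Ioo] with u hu k hk
    have h := (hd _ (hmem k hk u hu)).comp k ((hasDerivAt_id k).mul_const u)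
    simpa using h.mul_const (1 / √(u * (1 - u)))
  · filter_upwards [ae_restrict_mem measurableSet_Ioo] with u hu k hk
    have h : ContinuousAt (fun y => R' (y * u)) k :=
      ContinuousAt.comp (g := R') (f := fun y => y * u)
        (hc.continuousAt (isOpen_Ioo.mem_nhds (hmem k hk u hu))) (by fun_prop)
    exact (h.mul continuousAt_const).mul continuousAt_const
  · intro k hk
    -- The neighborhood (k/2, (k+K)/2) keeps the parameter away from 0, for the division by it, and
    -- away from K, for the bound B.
    obtain ⟨B, hB⟩ := hb' ((k + K) / 2) ⟨by linarith [hk.1, hk.2], by linarith [hk.2]⟩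
    refine ⟨fun u => B / (k / 2) * (1 / √(u * (1 - u))),
      integrableOn_one_div_sqrt_mul_one_sub.integrable.const_mul _, Ioo (k / 2) ((k + K) / 2),
      isOpen_Ioo.mem_nhds ⟨by linarith [hk.1], by linarith [hk.2]⟩, ?_⟩
    filter_upwards [ae_restrict_mem measurableSet_Ioo] with u hu x hx
    have hk2 : 0 < k / 2 := by linarith [hk.1]
    have hx0 : 0 < x := hk2.trans hx.1
    have hBx := hB (x * u) ⟨mul_pos hx0 hu.1, by nlinarith [hx.2, hu.2]⟩
    rw [abs_mul, abs_of_nonneg (show 0 ≤ 1 / √(u * (1 - u)) by positivity)]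
    refine mul_le_mul_of_nonneg_right ?_ (by positivity)
    rw [le_div_iff₀ hk2]
    calc |R' (x * u) * u| * (k / 2) ≤ |R' (x * u) * u| * x :=
          mul_le_mul_of_nonneg_left hx.1.le (abs_nonneg _)
      _ = |x * u * R' (x * u)| := by
          rw [← abs_of_pos hx0, ← abs_mul, abs_of_pos hx0]
          ring_nf
      _ ≤ B := hBx

end ScaledIntegral

/-! ### The two branches of the inverse of x - 1 - log x -/

/-- A branch over `(0, K)` of the inverse of `logGap`, with values in `(0, 1 / a)`. -/
structure IsBranch (a K : ℝ) (g : ℝ → ℝ) : Prop where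
  pos : ∀ k ∈ Ioo 0 K, 0 < g k
  lt : ∀ k ∈ Ioo 0 K, a * g k < 1
  ne : ∀ k ∈ Ioo 0 K, g k ≠ 1
  eq : ∀ k ∈ Ioo 0 K, logGap (g k) = k
  deriv : ∀ k ∈ Ioo 0 K, HasDerivAt g (g k / (g k - 1)) k
  bdd : ∀ k ∈ Ioo 0 K, ∃ l r, 0 < l ∧ a * r < 1 ∧ ∀ x ∈ Ioc 0 k, l ≤ g x ∧ g x ≤ r

noncomputable def upperBranch : ℝ → ℝ := Function.invFunOn logGap (Ioi 1)

noncomputable def lowerBranch : ℝ → ℝ := Function.invFunOn logGap (Ioo 0 1)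

theorem one_lt_upperBranch {k : ℝ} (hk : 0 < k) : 1 < upperBranch k :=
  Function.invFunOn_mem (exists_logGap_eq_of_one_lt hk)

theorem logGap_upperBranch {k : ℝ} (hk : 0 < k) : logGap (upperBranch k) = k :=
  Function.invFunOn_eq (exists_logGap_eq_of_one_lt hk)

theorem lowerBranch_mem {k : ℝ} (hk : 0 < k) : lowerBranch k ∈ Ioo (0 : ℝ) 1 :=
  Function.invFunOn_mem (exists_logGap_eq_of_lt_one hk)

theorem logGap_lowerBranch {k : ℝ} (hk : 0 < k) : logGap (lowerBranch k) = k :=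
  Function.invFunOn_eq (exists_logGap_eq_of_lt_one hk)

theorem inv_one_sub_inv {x : ℝ} (h0 : x ≠ 0) : (1 - x⁻¹)⁻¹ = x / (x - 1) := by
  rw [← one_div, ← one_div, one_sub_div h0, one_div_div]

/-- The endpoint `logGap` (1/a) is where a x reaches 1, that is φ = 0: the homoclinic level. The
lower branch stays below 1 < 1/a and meets no such barrier. -/
theorem isBranch_upperBranch {a : ℝ} (ha : 0 < a) (ha1 : a < 1) :
    IsBranch a (logGap (1 / a)) upperBranch := by
  have h1a : 1 < 1 / a := by rwa [one_lt_div ha]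
  have hlt : ∀ k ∈ Ioo 0 (logGap (1 / a)), a * upperBranch k < 1 := by
    intro k hk
    have := (strictMonoOn_logGap.lt_iff_lt (one_lt_upperBranch hk.1).le h1a.le).1
      (by rw [logGap_upperBranch hk.1]; exact hk.2)
    rwa [lt_div_iff₀ ha, mul_comm] at this
  refine ⟨fun k hk => by linarith [one_lt_upperBranch hk.1], hlt,
    fun k hk => (one_lt_upperBranch hk.1).ne', fun k hk => logGap_upperBranch hk.1,
    fun k hk => ?_, fun k hk => ⟨1, upperBranch k, one_pos, hlt k hk, fun x hx =>
      ⟨(one_lt_upperBranch hx.1).le, ?_⟩⟩⟩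
  · have h1 := one_lt_upperBranch hk.1
    have h := hasStrictDerivAt_invFunOn isOpen_Ioi
      (strictMonoOn_logGap.mono Ioi_subset_Ici_self).injOn h1
      (hasStrictDerivAt_logGap (by linarith))
      (by have := inv_lt_one_of_one_lt₀ h1; linarith)
    rw [logGap_upperBranch hk.1, inv_one_sub_inv (by linarith)] at h
    exact h.hasDerivAt
  · refine (strictMonoOn_logGap.le_iff_le (one_lt_upperBranch hx.1).le
      (one_lt_upperBranch hk.1).le).1 ?_
    rw [logGap_upperBranch hx.1, logGap_upperBranch hk.1]
    exact hx.2

theorem isBranch_lowerBranch {a K : ℝ} (ha : 0 < a) (ha1 : a < 1) :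
    IsBranch a K lowerBranch := by
  refine ⟨fun k hk => (lowerBranch_mem hk.1).1,
    fun k hk => by nlinarith [(lowerBranch_mem hk.1).2],
    fun k hk => (lowerBranch_mem hk.1).2.ne, fun k hk => logGap_lowerBranch hk.1,
    fun k hk => ?_, fun k hk => ⟨lowerBranch k, 1, (lowerBranch_mem hk.1).1, by linarith,
      fun x hx => ⟨?_, (lowerBranch_mem hx.1).2.le⟩⟩⟩
  · have h1 := lowerBranch_mem hk.1
    have h := hasStrictDerivAt_invFunOn isOpen_Ioo
      (strictAntiOn_logGap.mono Ioo_subset_Ioc_self).injOn h1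
      (hasStrictDerivAt_logGap h1.1)
      (by have := (one_lt_inv₀ h1.1).2 h1.2; linarith)
    rw [logGap_lowerBranch hk.1, inv_one_sub_inv h1.1.ne'] at h
    exact h.hasDerivAt
  · refine (strictAntiOn_logGap.le_iff_ge (Ioo_subset_Ioc_self (lowerBranch_mem hx.1))
      (Ioo_subset_Ioc_self (lowerBranch_mem hk.1))).1 ?_
    rw [logGap_lowerBranch hx.1, logGap_lowerBranch hk.1]
    exact hx.2

/-! ### The density of the period along a branch -/

/-- The density of the period with respect to the rescaled potential, as a function of the point
`x` of a branch. -/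
noncomputable def density (a k x : ℝ) : ℝ := √k * (x / ((x - 1) * √(1 - a * x)))

/-- `√k` times the derivative of the density along a branch. -/
noncomputable def densitySlope (a x : ℝ) : ℝ :=
  (√(1 - a * x))⁻¹ * (x / (2 * (x - 1)) - logGap x * x / (x - 1) ^ 3) +
    a / (2 * (1 - a * x) * √(1 - a * x)) * (x ^ 2 * logGap x / (x - 1) ^ 2)

/-- Substituting k = `logGap` (g k) removes k from all but the factor 1/√k, so the slopes on the two
branches can be compared without relating their points. -/
theorem IsBranch.hasDerivAt_density {a K : ℝ} {g : ℝ → ℝ} (hg : IsBranch a K g) {k : ℝ}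
    (hk : k ∈ Ioo 0 K) :
    HasDerivAt (fun k => density a k (g k)) (densitySlope a (g k) / √k) k := by
  have hgd := hg.deriv k hk
  have heq := hg.eq k hk
  have h1 := sub_ne_zero.2 (hg.ne k hk)
  have ha : 0 < 1 - a * g k := by linarith [hg.lt k hk]
  have hs := Real.sqrt_pos.2 ha
  have hs2 : √(1 - a * g k) ^ 2 = 1 - a * g k := Real.sq_sqrt ha.le
  have hk0 := hk.1
  have hks := Real.sqrt_pos.2 hk0
  have hks2 : √k ^ 2 = k := Real.sq_sqrt hk0.le
  have hw := ((hgd.const_mul a).const_sub 1).sqrt ha.ne'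
  have h := ((hasDerivAt_id k).sqrt hk0.ne').mul
    (hgd.div ((hgd.sub_const 1).mul hw) (mul_ne_zero h1 hs.ne'))
  refine h.congr_deriv ?_
  simp only [densitySlope, id, heq, Pi.mul_apply, Pi.div_apply]
  generalize g k = x at *
  generalize √(1 - a * x) = w at *
  generalize √k = q at *
  rw [← hs2, ← hks2]
  field_simp
  ring

theorem IsBranch.abs_density_le {a K : ℝ} {g : ℝ → ℝ} (ha : 0 < a) (hg : IsBranch a K g)
    {k : ℝ} (hk : k ∈ Ioo 0 K) : ∃ B, ∀ x ∈ Ioc 0 k, |density a x (g x)| ≤ B := by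
  obtain ⟨l, r, hl, hr, hlr⟩ := hg.bdd k hk
  refine ⟨√(r / (1 - a * r)), fun x hx => Real.le_sqrt_of_sq_le ?_⟩
  have hxK : x ∈ Ioo 0 K := ⟨hx.1, hx.2.trans_lt hk.2⟩
  obtain ⟨hlx, hrx⟩ := hlr x hx
  have h0 := hg.pos x hxK
  have h1 := sub_ne_zero.2 (hg.ne x hxK)
  have hle := logGap_le h0
  rw [hg.eq x hxK] at hle
  have har : 0 < 1 - a * r := by linarith
  have hax : 1 - a * r ≤ 1 - a * g x := by nlinarith
  have hr0 : 0 < r := h0.trans_le hrx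
  rw [sq_abs, density, mul_pow, div_pow, mul_pow, Real.sq_sqrt hx.1.le,
    Real.sq_sqrt (har.le.trans hax)]
  have h2 : 0 < (g x - 1) ^ 2 := by positivity
  have h3 : 0 < 1 - a * g x := har.trans_le hax
  calc x * (g x ^ 2 / ((g x - 1) ^ 2 * (1 - a * g x)))
      ≤ (g x - 1) ^ 2 / g x * (g x ^ 2 / ((g x - 1) ^ 2 * (1 - a * g x))) := by gcongr
    _ = g x / (1 - a * g x) := by field_simp
    _ ≤ r / (1 - a * r) := by gcongr

theorem IsBranch.abs_mul_deriv_density_le {a K : ℝ} {g : ℝ → ℝ} (ha : 0 < a)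
    (hg : IsBranch a K g) {k : ℝ} (hk : k ∈ Ioo 0 K) :
    ∃ B, ∀ x ∈ Ioc 0 k, |x * (densitySlope a (g x) / √x)| ≤ B := by
  obtain ⟨l, r, hl, hr, hlr⟩ := hg.bdd k hk
  obtain ⟨B, hB⟩ := hg.abs_density_le ha hk
  -- The three summands bound the three terms of `hsplit`. Each pole at g x = 1 is absorbed by x ≤
  -- (g x - 1)² / g x.
  refine ⟨B / 2 + B * (1 / l) + √k * (a / (2 * (1 - a * r) * √(1 - a * r)) * r), fun x hx => ?_⟩
  have hxK : x ∈ Ioo 0 K := ⟨hx.1, hx.2.trans_lt hk.2⟩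
  obtain ⟨hlx, hrx⟩ := hlr x hx
  have hBx := hB x hx
  have h0 := hg.pos x hxK
  have h1 := sub_ne_zero.2 (hg.ne x hxK)
  have hle := logGap_le h0
  rw [hg.eq x hxK] at hle
  have har : 0 < 1 - a * r := by linarith
  have hax : 1 - a * r ≤ 1 - a * g x := by nlinarith
  have hr0 : 0 < r := h0.trans_le hrx
  have h2 : 0 < (g x - 1) ^ 2 := by positivity
  have h3 : 0 < 1 - a * g x := har.trans_le hax
  have hs := Real.sqrt_pos.2 h3
  have hsr := Real.sqrt_pos.2 har
  have hx0 := hx.1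
  have hsplit : x * (densitySlope a (g x) / √x) =
      density a x (g x) / 2 - density a x (g x) * (x / (g x - 1) ^ 2) +
        √x * (a / (2 * (1 - a * g x) * √(1 - a * g x)) * (g x ^ 2 * x / (g x - 1) ^ 2)) := by
    rw [mul_div_left_comm, Real.div_sqrt, densitySlope, density, hg.eq x hxK]
    field_simp
  have hb1 : |density a x (g x) / 2| ≤ B / 2 := by
    rw [abs_div, abs_two]
    gcongr
  have hb2 : |density a x (g x) * (x / (g x - 1) ^ 2)| ≤ B * (1 / l) := by
    rw [abs_mul, abs_of_nonneg (show 0 ≤ x / (g x - 1) ^ 2 by positivity)]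
    refine mul_le_mul hBx ?_ (by positivity) ((abs_nonneg _).trans hBx)
    calc x / (g x - 1) ^ 2 ≤ (g x - 1) ^ 2 / g x / (g x - 1) ^ 2 := by gcongr
      _ = 1 / g x := by field_simp
      _ ≤ 1 / l := by gcongr
  have hb3 : |√x * (a / (2 * (1 - a * g x) * √(1 - a * g x)) * (g x ^ 2 * x / (g x - 1) ^ 2))| ≤
      √k * (a / (2 * (1 - a * r) * √(1 - a * r)) * r) := by
    rw [abs_of_nonneg (by positivity)]
    have hC : g x ^ 2 * x / (g x - 1) ^ 2 ≤ r := by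
      calc g x ^ 2 * x / (g x - 1) ^ 2
          ≤ g x ^ 2 * ((g x - 1) ^ 2 / g x) / (g x - 1) ^ 2 := by gcongr
        _ = g x := by field_simp
        _ ≤ r := hrx
    have := hx.2
    gcongr
  rw [hsplit]
  exact (abs_add_le _ _).trans (add_le_add ((abs_sub _ _).trans (add_le_add hb1 hb2)) hb3)

/-- Both brackets of `densitySlope` lie below their limits 1/3 and 1/2 at 1 when the argument is
below 1, and above them when it is above 1. Their positive weights increase with the argument too,
so the limit of `densitySlope` at 1 separates the two values. -/
theorem densitySlope_lt_of_lt_of_gt {a x y : ℝ} (ha : 0 < a) (hx : 0 < x) (hx1 : x < 1)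
    (hy1 : 1 < y) (hy : a * y < 1) : densitySlope a x < densitySlope a y := by
  have hy0 : 0 < y := by linarith
  have ha1 : a < 1 := by nlinarith
  have hax : a * x < a := by nlinarith
  have hay : a < a * y := by nlinarith
  have hpx : 0 < 1 - a * x := by linarith
  have hpy : 0 < 1 - a * y := by linarith
  have hp : 0 < 1 - a := by linarith
  have hsx := Real.sqrt_pos.2 hpx
  have hsy := Real.sqrt_pos.2 hpy
  have hs := Real.sqrt_pos.2 hp
  have hB : ∀ z : ℝ, 0 < z → z ≠ 1 → z / (2 * (z - 1)) - logGap z * z / (z - 1) ^ 3 =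
      1 / 3 + z * ((z - 1) ^ 2 - 2 * logGap z - 2 / 3 * ((z - 1) ^ 3 / z)) /
        (2 * (z - 1) ^ 3) := by
    intro z hz hz1
    have := sub_ne_zero.2 hz1
    field_simp
    ring
  have hC : ∀ z : ℝ, 0 < z → z ≠ 1 → z ^ 2 * logGap z / (z - 1) ^ 2 =
      1 / 2 + (z - 1) * (logGap z - (1 / 2) * (1 - z⁻¹) ^ 2) * z ^ 2 / (z - 1) ^ 3 := by
    intro z hz hz1
    have := sub_ne_zero.2 hz1
    field_simp
    ring
  have hBx : x / (2 * (x - 1)) - logGap x * x / (x - 1) ^ 3 < 1 / 3 := by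
    rw [hB x hx hx1.ne]
    have h1 := mul_pos hx (sq_sub_two_mul_logGap_gt hx hx1.ne)
    have h2 : (x - 1) ^ 3 < 0 := Odd.pow_neg (by decide) (by linarith)
    have := div_neg_of_pos_of_neg h1 (show 2 * (x - 1) ^ 3 < 0 by linarith)
    linarith
  have hCx : x ^ 2 * logGap x / (x - 1) ^ 2 < 1 / 2 := by
    rw [hC x hx hx1.ne]
    have h1 := mul_pos (logGap_sub_sign hx hx1.ne) (pow_pos hx 2)
    have h2 : (x - 1) ^ 3 < 0 := Odd.pow_neg (by decide) (by linarith)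
    have := div_neg_of_pos_of_neg h1 h2
    linarith
  have hBy : 1 / 3 < y / (2 * (y - 1)) - logGap y * y / (y - 1) ^ 3 := by
    rw [hB y hy0 hy1.ne']
    have h1 := mul_pos hy0 (sq_sub_two_mul_logGap_gt hy0 hy1.ne')
    have h2 : 0 < (y - 1) ^ 3 := pow_pos (by linarith) 3
    have := div_pos h1 (show 0 < 2 * (y - 1) ^ 3 by linarith)
    linarith
  have hCy : 1 / 2 < y ^ 2 * logGap y / (y - 1) ^ 2 := by
    rw [hC y hy0 hy1.ne']
    have h1 := mul_pos (logGap_sub_sign hy0 hy1.ne') (pow_pos hy0 2)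
    have h2 : 0 < (y - 1) ^ 3 := pow_pos (by linarith) 3
    have := div_pos h1 h2
    linarith
  have hlow : densitySlope a x <
      (√(1 - a))⁻¹ * (1 / 3) + a / (2 * (1 - a) * √(1 - a)) * (1 / 2) := by
    unfold densitySlope
    refine add_lt_add ((mul_lt_mul_of_pos_left hBx (by positivity)).trans_le ?_)
      ((mul_lt_mul_of_pos_left hCx (by positivity)).trans_le ?_)
    · gcongr
    · gcongr
  refine hlow.trans ?_
  unfold densitySlope
  refine add_lt_add (lt_of_le_of_lt ?_ (mul_lt_mul_of_pos_left hBy (by positivity)))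
    (lt_of_le_of_lt ?_ (mul_lt_mul_of_pos_left hCy (by positivity)))
  · gcongr
  · gcongr

/-! ### The range of the orbit and the change of variables on one arc -/

theorem mem_orbitRange {ω 𝓔 φ : ℝ} :
    φ ∈ orbitRange ω 𝓔 ↔
      -1 < φ ∧ φ < 1 ∧ potential ω φ ≤ 𝓔 ∧ (𝓔 < criticalEnergy ω → 0 < φ) := by
  unfold orbitRange periodicOrbit energy
  constructor
  · rintro ⟨⟨φ, ξ⟩, ⟨h1, h2, h3, h4⟩, rfl⟩
    simp only at h1 h2 h3 h4 ⊢
    exact ⟨h1, h2, by nlinarith [sq_nonneg ξ], h4⟩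
  · rintro ⟨h1, h2, h3, h4⟩
    refine ⟨(φ, √(2 * (𝓔 - potential ω φ))), ⟨h1, h2, ?_, h4⟩, rfl⟩
    simp only
    rw [Real.sq_sqrt (by linarith)]
    ring

theorem logGap_injOn_Ioi : InjOn logGap (Ioi 1) :=
  (strictMonoOn_logGap.mono Ioi_subset_Ici_self).injOn

theorem logGap_injOn_Ioo : InjOn logGap (Ioo 0 1) :=
  (strictAntiOn_logGap.mono Ioo_subset_Ioc_self).injOn

section Branch

variable {ω K k : ℝ} {g : ℝ → ℝ}

/-- The arc of the orbit over a branch, parametrized by the rescaled potential. -/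
noncomputable def branchArc (ω k : ℝ) (g : ℝ → ℝ) (u : ℝ) : ℝ := √(1 - (1 - ω) * g (k * u))

theorem mul_mem_Ioo (hk : k ∈ Ioo 0 K) {u : ℝ} (hu : u ∈ Ioo (0 : ℝ) 1) : k * u ∈ Ioo 0 K :=
  ⟨mul_pos hk.1 hu.1, by nlinarith [hk.1, hk.2, hu.2]⟩

theorem IsBranch.branchArc_sq (hg : IsBranch (1 - ω) K g) (hk : k ∈ Ioo 0 K) {u : ℝ}
    (hu : u ∈ Ioo (0 : ℝ) 1) : branchArc ω k g u ^ 2 = 1 - (1 - ω) * g (k * u) :=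
  Real.sq_sqrt (by linarith [hg.lt _ (mul_mem_Ioo hk hu)])

theorem IsBranch.branchArc_pos (hg : IsBranch (1 - ω) K g) (hk : k ∈ Ioo 0 K) {u : ℝ}
    (hu : u ∈ Ioo (0 : ℝ) 1) : 0 < branchArc ω k g u :=
  Real.sqrt_pos.2 (by linarith [hg.lt _ (mul_mem_Ioo hk hu)])

theorem IsBranch.branchArc_sq_lt (hω : ω < 1) (hg : IsBranch (1 - ω) K g) (hk : k ∈ Ioo 0 K)
    {u : ℝ} (hu : u ∈ Ioo (0 : ℝ) 1) : branchArc ω k g u ^ 2 < 1 := by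
  rw [hg.branchArc_sq hk hu]
  have := mul_pos (sub_pos.2 hω) (hg.pos _ (mul_mem_Ioo hk hu))
  linarith

theorem IsBranch.branchArc_inv (hω : ω < 1) (hg : IsBranch (1 - ω) K g) (hk : k ∈ Ioo 0 K)
    {u : ℝ} (hu : u ∈ Ioo (0 : ℝ) 1) :
    (1 - branchArc ω k g u ^ 2) / (1 - ω) = g (k * u) := by
  have : 1 - ω ≠ 0 := by linarith
  rw [hg.branchArc_sq hk hu]
  field_simp
  ring

theorem IsBranch.potential_branchArc (hω : ω < 1) (hg : IsBranch (1 - ω) K g)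
    (hk : k ∈ Ioo 0 K) {u : ℝ} (hu : u ∈ Ioo (0 : ℝ) 1) :
    potential ω (branchArc ω k g u) = (1 - ω) / 2 * (k * u) := by
  rw [potential_eq hω (hg.branchArc_sq_lt hω hk hu), hg.branchArc_inv hω hk hu,
    hg.eq _ (mul_mem_Ioo hk hu)]

theorem IsBranch.injOn_branchArc (hω : ω < 1) (hg : IsBranch (1 - ω) K g) (hk : k ∈ Ioo 0 K) :
    InjOn (branchArc ω k g) (Ioo 0 1) := by
  intro u hu v hv h
  have hu' := hg.potential_branchArc hω hk hu
  rw [h, hg.potential_branchArc hω hk hv] at hu'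
  have h1 : (1 - ω) / 2 ≠ 0 := by linarith
  exact (mul_left_cancel₀ hk.1.ne' (mul_left_cancel₀ h1 hu')).symm

theorem IsBranch.hasDerivAt_branchArc (hg : IsBranch (1 - ω) K g) (hk : k ∈ Ioo 0 K) {u : ℝ}
    (hu : u ∈ Ioo (0 : ℝ) 1) :
    HasDerivAt (branchArc ω k g) (-((1 - ω) * (g (k * u) / (g (k * u) - 1) * k)) /
      (2 * √(1 - (1 - ω) * g (k * u)))) u := by
  have hku := mul_mem_Ioo hk hu
  have h : HasDerivAt (fun u => g (k * u)) (g (k * u) / (g (k * u) - 1) * k) u := by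
    simpa [Function.comp_def] using (hg.deriv _ hku).comp u ((hasDerivAt_id u).const_mul k)
  exact ((h.const_mul (1 - ω)).const_sub 1).sqrt (by linarith [hg.lt _ hku])

theorem IsBranch.measurableSet_image_branchArc (hω : ω < 1) (hg : IsBranch (1 - ω) K g)
    (hk : k ∈ Ioo 0 K) : MeasurableSet (branchArc ω k g '' Ioo 0 1) :=
  measurableSet_Ioo.image_of_continuousOn_injOn
    (fun _ hu => (hg.hasDerivAt_branchArc hk hu).continuousAt.continuousWithinAt)
    (hg.injOn_branchArc hω hk)

/-- On the arc 2(𝓔 - V) = (1-ω) k (1-u), and the Jacobian supplies a factor k. Multiplying and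
dividing by √u splits off the weight 1/√(u(1-u)) and leaves the √(ku) of `density`. -/
theorem IsBranch.abs_deriv_branchArc_mul (hω : ω < 1) (hg : IsBranch (1 - ω) K g)
    (hk : k ∈ Ioo 0 K) {u : ℝ} (hu : u ∈ Ioo (0 : ℝ) 1) :
    |-((1 - ω) * (g (k * u) / (g (k * u) - 1) * k)) / (2 * √(1 - (1 - ω) * g (k * u)))| •
      periodIntegrand ω ((1 - ω) / 2 * k) (branchArc ω k g u) =
    √(1 - ω) / 2 * |density (1 - ω) (k * u) (g (k * u)) * (1 / √(u * (1 - u)))| := by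
  have hku := mul_mem_Ioo hk hu
  have h1 := sub_ne_zero.2 (hg.ne _ hku)
  have h0 := hg.pos _ hku
  have hs := Real.sqrt_pos.2 (show 0 < 1 - (1 - ω) * g (k * u) by linarith [hg.lt _ hku])
  have ha : 0 < 1 - ω := by linarith
  have hu0 := hu.1
  have hu1 : 0 < 1 - u := by linarith [hu.2]
  have hk0 := hk.1
  have hE : 2 * ((1 - ω) / 2 * k - (1 - ω) / 2 * (k * u)) = (1 - ω) * (k * (1 - u)) := by ring
  rw [periodIntegrand, hg.potential_branchArc hω hk hu, hE, density, Real.sqrt_mul ha.le,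
    Real.sqrt_mul hk0.le, Real.sqrt_mul hk0.le, Real.sqrt_mul hu0.le]
  have hsa := Real.sqrt_pos.2 ha
  have hsk := Real.sqrt_pos.2 hk0
  have hsu := Real.sqrt_pos.2 hu0
  have hsv := Real.sqrt_pos.2 hu1
  have ha2 : √(1 - ω) ^ 2 = 1 - ω := Real.sq_sqrt ha.le
  have hk2 : √k ^ 2 = k := Real.sq_sqrt hk0.le
  have h1' := abs_pos.2 h1
  simp only [abs_mul, abs_div, abs_neg, abs_of_pos ha, abs_of_pos h0, abs_of_pos hk0,
    abs_of_pos hs, abs_of_pos hsk, abs_of_pos hsu, abs_of_pos hsv, abs_two, abs_one, smul_eq_mul]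
  field_simp
  rw [ha2, hk2]

theorem IsBranch.integrableOn_density (ha : 0 < 1 - ω) (hg : IsBranch (1 - ω) K g)
    (hk : k ∈ Ioo 0 K) :
    IntegrableOn (fun u => density (1 - ω) (k * u) (g (k * u)) * (1 / √(u * (1 - u))))
      (Ioo 0 1) :=
  integrableOn_scaled_div_sqrt (R := fun x => density (1 - ω) x (g x)) (K := K)
    (fun _ hx => (hg.hasDerivAt_density hx).continuousAt.continuousWithinAt)
    (fun _ hk => hg.abs_density_le ha hk) hk

theorem IsBranch.integrableOn_image (hω : ω < 1) (hg : IsBranch (1 - ω) K g)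
    (hk : k ∈ Ioo 0 K) :
    IntegrableOn (periodIntegrand ω ((1 - ω) / 2 * k)) (branchArc ω k g '' Ioo 0 1) := by
  rw [integrableOn_image_iff_integrableOn_abs_deriv_smul measurableSet_Ioo
    (fun u hu => (hg.hasDerivAt_branchArc hk hu).hasDerivWithinAt) (hg.injOn_branchArc hω hk)]
  refine IntegrableOn.congr_fun ?_ (fun u hu => (hg.abs_deriv_branchArc_mul hω hk hu).symm)
    measurableSet_Ioo
  exact (hg.integrableOn_density (sub_pos.2 hω) hk).integrable.abs.const_mul _

theorem IsBranch.integral_image (hω : ω < 1) (hg : IsBranch (1 - ω) K g) (hk : k ∈ Ioo 0 K) :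
    ∫ φ in branchArc ω k g '' Ioo 0 1, periodIntegrand ω ((1 - ω) / 2 * k) φ =
      √(1 - ω) / 2 *
        ∫ u in Ioo 0 1, |density (1 - ω) (k * u) (g (k * u)) * (1 / √(u * (1 - u)))| := by
  rw [integral_image_eq_integral_abs_deriv_smul measurableSet_Ioo
    (fun u hu => (hg.hasDerivAt_branchArc hk hu).hasDerivWithinAt) (hg.injOn_branchArc hω hk),
    setIntegral_congr_fun measurableSet_Ioo (fun u hu => hg.abs_deriv_branchArc_mul hω hk hu),
    integral_const_mul]

end Branch

/-! ### Even waves -/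

section Even

variable {ω k : ℝ}

theorem criticalEnergy_eq_logGap (hω : ω < 1) :
    criticalEnergy ω = (1 - ω) / 2 * logGap (1 / (1 - ω)) := by
  rw [criticalEnergy_eq, potential_eq hω (by norm_num)]
  norm_num

theorem lt_criticalEnergy_iff (hω : ω < 1) :
    (1 - ω) / 2 * k < criticalEnergy ω ↔ k < logGap (1 / (1 - ω)) := by
  rw [criticalEnergy_eq_logGap hω]
  exact mul_lt_mul_iff_right₀ (by linarith)

theorem orbitRange_ae_eq (h0 : 0 < ω) (hω : ω < 1) (hk : k ∈ Ioo 0 (logGap (1 / (1 - ω)))) :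
    orbitRange ω ((1 - ω) / 2 * k) =ᵐ[volume]
      (branchArc ω k lowerBranch '' Ioo 0 1 ∪ branchArc ω k upperBranch '' Ioo 0 1 : Set ℝ) := by
  have ha : 0 < 1 - ω := by linarith
  have hlow : IsBranch (1 - ω) (logGap (1 / (1 - ω))) lowerBranch :=
    isBranch_lowerBranch ha (by linarith)
  have hupp : IsBranch (1 - ω) (logGap (1 / (1 - ω))) upperBranch :=
    isBranch_upperBranch ha (by linarith)
  have hcrit := (lt_criticalEnergy_iff hω).2 hk.2
  rw [ae_eq_set]
  constructor
  -- The arcs miss at most three points: the center, where x = 1, and the two turning points, where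
  -- `logGap` x = k.
  · refine measure_mono_null (t := {√(1 - (1 - ω) * 1), √(1 - (1 - ω) * lowerBranch k),
      √(1 - (1 - ω) * upperBranch k)}) ?_ (Set.Finite.measure_zero (by simp) _)
    rintro φ ⟨hφ, hn⟩
    obtain ⟨-, hφ1, hV, hφ0⟩ := mem_orbitRange.1 hφ
    replace hφ0 := hφ0 hcrit
    have hsq : φ ^ 2 < 1 := by nlinarith
    rw [potential_eq hω hsq] at hV
    replace hV := le_of_mul_le_mul_left hV (by linarith)
    set x := (1 - φ ^ 2) / (1 - ω) with hx
    have hx0 : 0 < x := div_pos (by linarith) ha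
    have hφx : φ = √(1 - (1 - ω) * x) := by
      rw [hx, mul_div_cancel₀ _ ha.ne', sub_sub_cancel, Real.sqrt_sq hφ0.le]
    have hu : logGap x ≠ k → x ≠ 1 → k * (logGap x / k) = logGap x ∧
        logGap x / k ∈ Ioo (0 : ℝ) 1 := fun h1 h2 =>
      ⟨mul_div_cancel₀ _ hk.1.ne', div_pos (logGap_pos hx0 h2) hk.1,
        (div_lt_one hk.1).2 (lt_of_le_of_ne hV h1)⟩
    rcases lt_trichotomy x 1 with h | h | h
    · have hinv : lowerBranch (logGap x) = x := logGap_injOn_Ioo.leftInvOn_invFunOn ⟨hx0, h⟩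
      by_cases hxk : logGap x = k
      · rw [hxk] at hinv
        rw [hφx, ← hinv]
        simp
      · refine absurd (Or.inl ⟨logGap x / k, (hu hxk h.ne).2, ?_⟩) hn
        rw [branchArc, (hu hxk h.ne).1, hinv, ← hφx]
    · rw [hφx, h]
      simp
    · have hinv : upperBranch (logGap x) = x := logGap_injOn_Ioi.leftInvOn_invFunOn h
      by_cases hxk : logGap x = k
      · rw [hxk] at hinv
        rw [hφx, ← hinv]
        simp
      · refine absurd (Or.inr ⟨logGap x / k, (hu hxk h.ne').2, ?_⟩) hn
        rw [branchArc, (hu hxk h.ne').1, hinv, ← hφx]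
  · convert measure_empty (μ := volume)
    rw [sdiff_eq_empty]
    have key : ∀ g, IsBranch (1 - ω) (logGap (1 / (1 - ω))) g →
        branchArc ω k g '' Ioo 0 1 ⊆ orbitRange ω ((1 - ω) / 2 * k) := by
      rintro g hg _ ⟨u, hu, rfl⟩
      have h1 := hg.branchArc_pos hk hu
      have h2 := hg.branchArc_sq_lt hω hk hu
      refine mem_orbitRange.2 ⟨by linarith, by nlinarith, ?_, fun _ => h1⟩
      rw [hg.potential_branchArc hω hk hu]
      have : k * u ≤ k := by nlinarith [hu.2, hk.1]
      gcongr
    exact union_subset (key _ hlow) (key _ hupp)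

theorem integrableOn_orbitRange_even (h0 : 0 < ω) (hω : ω < 1)
    (hk : k ∈ Ioo 0 (logGap (1 / (1 - ω)))) :
    IntegrableOn (periodIntegrand ω ((1 - ω) / 2 * k)) (orbitRange ω ((1 - ω) / 2 * k)) := by
  have ha : 0 < 1 - ω := by linarith
  exact (((isBranch_lowerBranch ha (by linarith)).integrableOn_image hω hk).union
    ((isBranch_upperBranch ha (by linarith)).integrableOn_image hω hk)).congr_set_ae
      (orbitRange_ae_eq h0 hω hk)

theorem density_lowerBranch_nonpos {a k : ℝ} (hk : 0 < k) :
    density a k (lowerBranch k) ≤ 0 := by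
  have h := lowerBranch_mem hk
  refine mul_nonpos_of_nonneg_of_nonpos (Real.sqrt_nonneg _)
    (div_nonpos_of_nonneg_of_nonpos h.1.le ?_)
  exact mul_nonpos_of_nonpos_of_nonneg (by linarith [h.2]) (Real.sqrt_nonneg _)

theorem density_upperBranch_nonneg {a k : ℝ} (hk : 0 < k) :
    0 ≤ density a k (upperBranch k) := by
  have h := one_lt_upperBranch hk
  refine mul_nonneg (Real.sqrt_nonneg _) (div_nonneg (by linarith) ?_)
  exact mul_nonneg (by linarith) (Real.sqrt_nonneg _)

theorem period_even (h0 : 0 < ω) (hω : ω < 1) (hk : k ∈ Ioo 0 (logGap (1 / (1 - ω)))) :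
    period ((1 - ω) / 2 * k) ω = √(1 - ω) *
      ((∫ u in Ioo 0 1, density (1 - ω) (k * u) (upperBranch (k * u)) * (1 / √(u * (1 - u)))) -
       ∫ u in Ioo 0 1, density (1 - ω) (k * u) (lowerBranch (k * u)) * (1 / √(u * (1 - u)))) := by
  have ha : 0 < 1 - ω := by linarith
  have hlow : IsBranch (1 - ω) (logGap (1 / (1 - ω))) lowerBranch :=
    isBranch_lowerBranch ha (by linarith)
  have hupp : IsBranch (1 - ω) (logGap (1 / (1 - ω))) upperBranch :=
    isBranch_upperBranch ha (by linarith)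
  have hdisj : Disjoint (branchArc ω k lowerBranch '' Ioo 0 1)
      (branchArc ω k upperBranch '' Ioo 0 1) := by
    rw [Set.disjoint_left]
    rintro _ ⟨u, hu, rfl⟩ ⟨v, hv, h⟩
    have h1 := hlow.branchArc_inv hω hk hu
    rw [← h, hupp.branchArc_inv hω hk hv] at h1
    have h2 := one_lt_upperBranch (mul_pos hk.1 hv.1)
    have h3 := (lowerBranch_mem (mul_pos hk.1 hu.1)).2
    linarith
  rw [period, setIntegral_congr_set (orbitRange_ae_eq h0 hω hk),
    setIntegral_union hdisj (hupp.measurableSet_image_branchArc hω hk)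
      (hlow.integrableOn_image hω hk) (hupp.integrableOn_image hω hk),
    hlow.integral_image hω hk, hupp.integral_image hω hk]
  have e1 : ∫ u in Ioo 0 1,
      |density (1 - ω) (k * u) (lowerBranch (k * u)) * (1 / √(u * (1 - u)))| =
      -∫ u in Ioo 0 1, density (1 - ω) (k * u) (lowerBranch (k * u)) * (1 / √(u * (1 - u))) := by
    rw [← integral_neg]
    refine setIntegral_congr_fun measurableSet_Ioo fun u hu => abs_of_nonpos ?_
    exact mul_nonpos_of_nonpos_of_nonneg (density_lowerBranch_nonpos (mul_pos hk.1 hu.1))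
      (by positivity)
  have e2 : ∫ u in Ioo 0 1,
      |density (1 - ω) (k * u) (upperBranch (k * u)) * (1 / √(u * (1 - u)))| =
      ∫ u in Ioo 0 1, density (1 - ω) (k * u) (upperBranch (k * u)) * (1 / √(u * (1 - u))) := by
    refine setIntegral_congr_fun measurableSet_Ioo fun u hu => abs_of_nonneg ?_
    exact mul_nonneg (density_upperBranch_nonneg (mul_pos hk.1 hu.1)) (by positivity)
  rw [e1, e2]
  ring

theorem IsBranch.contDiffOn_integral_density {a K : ℝ} {g : ℝ → ℝ} (ha : 0 < a)
    (hg : IsBranch a K g) :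
    ContDiffOn ℝ 1 (fun k => ∫ u in Ioo 0 1, density a (k * u) (g (k * u)) *
      (1 / √(u * (1 - u)))) (Ioo 0 K) := by
  refine contDiffOn_integral_scaled_div_sqrt (R := fun x => density a x (g x))
    (fun k hk => hg.hasDerivAt_density hk) (fun k hk => ?_)
    (fun k hk => hg.abs_density_le ha hk) (fun k hk => hg.abs_mul_deriv_density_le ha hk)
  refine ContinuousAt.continuousWithinAt ?_
  have hgc : ContinuousAt g k := (hg.deriv k hk).continuousAt
  have h0 := hg.pos k hk
  have h1 := sub_ne_zero.2 (hg.ne k hk)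
  have h2 : 0 < 1 - a * g k := by linarith [hg.lt k hk]
  have hs := Real.sqrt_pos.2 h2
  have hlog : ContinuousAt logGap (g k) := (hasDerivAt_logGap h0).continuousAt
  have hS : ContinuousAt (densitySlope a) (g k) := by
    unfold densitySlope
    have hsq : ContinuousAt (fun x => √(1 - a * x)) (g k) := by fun_prop
    have h3 : 2 * (g k - 1) ≠ 0 := mul_ne_zero two_ne_zero h1
    have h4 : (g k - 1) ^ 3 ≠ 0 := pow_ne_zero 3 h1
    have h5 : (g k - 1) ^ 2 ≠ 0 := pow_ne_zero 2 h1
    have h6 : 2 * (1 - a * g k) * √(1 - a * g k) ≠ 0 := by positivity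
    have h7 : √(1 - a * g k) ≠ 0 := hs.ne'
    fun_prop (disch := assumption)
  exact (ContinuousAt.comp (g := densitySlope a) hS hgc).div (by fun_prop)
    (Real.sqrt_pos.2 hk.1).ne'

theorem contDiffOn_period_even (h0 : 0 < ω) (hω : ω < 1) :
    ContDiffOn ℝ 1 (fun 𝓔 => period 𝓔 ω) (Ioo 0 (criticalEnergy ω)) := by
  have ha : 0 < 1 - ω := by linarith
  have hmap : MapsTo (fun 𝓔 => 𝓔 / ((1 - ω) / 2)) (Ioo 0 (criticalEnergy ω))
      (Ioo 0 (logGap (1 / (1 - ω)))) := fun 𝓔 h𝓔 => by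
    refine ⟨div_pos h𝓔.1 (by linarith), ?_⟩
    rw [← lt_criticalEnergy_iff hω, mul_div_cancel₀ _ (by linarith)]
    exact h𝓔.2
  have h := ((((isBranch_upperBranch ha (by linarith)).contDiffOn_integral_density ha).sub
    ((isBranch_lowerBranch ha (by linarith)).contDiffOn_integral_density ha)).const_smul
      √(1 - ω)).comp (contDiff_id.div_const ((1 - ω) / 2)).contDiffOn hmap
  refine h.congr fun 𝓔 h𝓔 => ?_
  have := period_even h0 hω (hmap h𝓔)
  rw [mul_div_cancel₀ _ (by linarith : (1 - ω) / 2 ≠ 0)] at this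
  exact this

theorem strictMonoOn_density_sub (h0 : 0 < ω) (hω : ω < 1) :
    StrictMonoOn (fun k => density (1 - ω) k (upperBranch k) - density (1 - ω) k (lowerBranch k))
      (Ioo 0 (logGap (1 / (1 - ω)))) := by
  have ha : 0 < 1 - ω := by linarith
  have hlow : IsBranch (1 - ω) (logGap (1 / (1 - ω))) lowerBranch :=
    isBranch_lowerBranch ha (by linarith)
  have hupp : IsBranch (1 - ω) (logGap (1 / (1 - ω))) upperBranch :=
    isBranch_upperBranch ha (by linarith)
  have hd : ∀ k ∈ Ioo 0 (logGap (1 / (1 - ω))), HasDerivAt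
      (fun k => density (1 - ω) k (upperBranch k) - density (1 - ω) k (lowerBranch k))
      (densitySlope (1 - ω) (upperBranch k) / √k - densitySlope (1 - ω) (lowerBranch k) / √k) k :=
    fun k hk => (hupp.hasDerivAt_density hk).sub (hlow.hasDerivAt_density hk)
  refine strictMonoOn_of_deriv_pos (convex_Ioo _ _)
    (fun k hk => (hd k hk).continuousAt.continuousWithinAt) fun k hk => ?_
  rw [interior_Ioo] at hk
  rw [(hd k hk).deriv, ← sub_div]
  have hl := lowerBranch_mem hk.1
  exact div_pos (sub_pos.2 (densitySlope_lt_of_lt_of_gt ha hl.1 hl.2 (one_lt_upperBranch hk.1)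
    (hupp.lt k hk))) (Real.sqrt_pos.2 hk.1)

theorem strictMonoOn_period_even (h0 : 0 < ω) (hω : ω < 1) :
    StrictMonoOn (fun 𝓔 => period 𝓔 ω) (Ioo 0 (criticalEnergy ω)) := by
  have ha : 0 < 1 - ω := by linarith
  have ha2 : 0 < (1 - ω) / 2 := by linarith
  have hlow : IsBranch (1 - ω) (logGap (1 / (1 - ω))) lowerBranch :=
    isBranch_lowerBranch ha (by linarith)
  have hupp : IsBranch (1 - ω) (logGap (1 / (1 - ω))) upperBranch :=
    isBranch_upperBranch ha (by linarith)
  have hmap : ∀ 𝓔 ∈ Ioo 0 (criticalEnergy ω), ∃ k ∈ Ioo 0 (logGap (1 / (1 - ω))),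
      𝓔 = (1 - ω) / 2 * k := fun 𝓔 h𝓔 => by
    have h : 𝓔 = (1 - ω) / 2 * (𝓔 / ((1 - ω) / 2)) := (mul_div_cancel₀ _ ha2.ne').symm
    refine ⟨_, ⟨div_pos h𝓔.1 ha2, ?_⟩, h⟩
    rw [← lt_criticalEnergy_iff hω, ← h]
    exact h𝓔.2
  intro x hx y hy hxy
  obtain ⟨k, hk, rfl⟩ := hmap x hx
  obtain ⟨l, hl, rfl⟩ := hmap y hy
  have hkl : k < l := lt_of_mul_lt_mul_left hxy ha2.le
  have hi : ∀ k ∈ Ioo 0 (logGap (1 / (1 - ω))), IntegrableOn (fun u =>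
      (density (1 - ω) (k * u) (upperBranch (k * u)) * (1 / √(u * (1 - u))) -
       density (1 - ω) (k * u) (lowerBranch (k * u)) * (1 / √(u * (1 - u))))) (Ioo 0 1) :=
    fun k hk => (hupp.integrableOn_density ha hk).sub (hlow.integrableOn_density ha hk)
  simp only
  rw [period_even h0 hω hk, period_even h0 hω hl,
    ← integral_sub (hupp.integrableOn_density ha hk) (hlow.integrableOn_density ha hk),
    ← integral_sub (hupp.integrableOn_density ha hl) (hlow.integrableOn_density ha hl)]
  refine mul_lt_mul_of_pos_left ?_ (Real.sqrt_pos.2 ha)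
  refine setIntegral_Ioo_lt one_pos (hi k hk) (hi l hl) fun u hu => ?_
  rw [← sub_mul, ← sub_mul]
  refine mul_lt_mul_of_pos_right ?_ (one_div_pos.2 (Real.sqrt_pos.2
    (mul_pos hu.1 (by linarith [hu.2]))))
  exact strictMonoOn_density_sub h0 hω (mul_mem_Ioo hk hu) (mul_mem_Ioo hl hu)
    (mul_lt_mul_of_pos_right hkl hu.1)

end Even

/-! ### Monotonicity of the rescaled energy drop for odd waves -/

section LogRatio

variable {a s τ : ℝ}

noncomputable def logRatio (s τ : ℝ) : ℝ := (Real.log (1 - τ * s) - Real.log (1 - s)) / s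

noncomputable def logRatioDeriv (s τ : ℝ) : ℝ :=
  (1 - τ) / ((1 - s) * (1 - τ * s)) / s - (Real.log (1 - τ * s) - Real.log (1 - s)) / s ^ 2

theorem hasDerivAt_logRatio (hs0 : 0 < s) (hs1 : s < 1) (hτ : τ ≤ 1) :
    HasDerivAt (fun s => logRatio s τ) (logRatioDeriv s τ) s := by
  have h1 : 1 - s ≠ 0 := by linarith
  have h2 : 1 - τ * s ≠ 0 := by nlinarith
  refine (((((hasDerivAt_id s).const_mul τ).const_sub 1).log h2).sub
    (((hasDerivAt_id s).const_sub 1).log h1)).div (hasDerivAt_id s) hs0.ne' |>.congr_deriv ?_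
  simp only [logRatioDeriv, id, Pi.sub_apply]
  field_simp
  ring

/-- Apply log z < z - 1 to z = (1 - τs)/(1 - s); then z - 1 = s(1-τ)/(1-s), which only grows on
division by 1 - τs ≤ 1. -/
theorem logRatioDeriv_pos (hs0 : 0 < s) (hs1 : s < 1) (hτ0 : 0 ≤ τ) (hτ : τ < 1) :
    0 < logRatioDeriv s τ := by
  have h1 : 0 < 1 - s := by linarith
  have h2 : 0 < 1 - τ * s := by nlinarith
  have h3 : 0 < 1 - τ := by linarith
  have hlog := Real.log_lt_sub_one_of_pos (div_pos h2 h1) (by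
    rw [Ne, div_eq_one_iff_eq h1.ne']
    nlinarith)
  rw [Real.log_div h2.ne' h1.ne'] at hlog
  have hle : (1 - τ * s) / (1 - s) - 1 ≤ s * ((1 - τ) / ((1 - s) * (1 - τ * s))) := by
    have : (1 - τ * s) / (1 - s) - 1 = s * ((1 - τ) / (1 - s)) := by
      field_simp
      ring
    rw [this]
    gcongr
    exact mul_le_of_le_one_right h1.le (by nlinarith)
  have heq : logRatioDeriv s τ = (s * ((1 - τ) / ((1 - s) * (1 - τ * s))) -
      (Real.log (1 - τ * s) - Real.log (1 - s))) / s ^ 2 := by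
    unfold logRatioDeriv
    field_simp
  rw [heq]
  exact div_pos (by linarith) (by positivity)

/-- The factor 1 - τ is essential: against the (1-τ)^(3/2) from the denominator it leaves the
integrable (1-τ)^(-1/2), with τ = t². -/
theorem logRatioDeriv_le (hs0 : 0 < s) (hs1 : s < 1) (hτ : τ < 1) :
    logRatioDeriv s τ ≤ (1 - τ) / (s * (1 - s) ^ 2) := by
  have h1 : 0 < 1 - s := by linarith
  have h2 : 1 - s ≤ 1 - τ * s := by nlinarith
  have h3 : 0 < 1 - τ := by linarith
  have hlog := Real.log_le_log h1 h2
  have hnn : 0 ≤ (Real.log (1 - τ * s) - Real.log (1 - s)) / s ^ 2 :=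
    div_nonneg (by linarith) (by positivity)
  have hle : (1 - τ) / ((1 - s) * (1 - τ * s)) / s ≤ (1 - τ) / (s * (1 - s) ^ 2) := by
    rw [div_div]
    have : s * (1 - s) ^ 2 ≤ (1 - s) * (1 - τ * s) * s := by
      nlinarith [mul_le_mul_of_nonneg_left h2 (mul_pos hs0 h1).le]
    gcongr
  unfold logRatioDeriv
  linarith

theorem strictMonoOn_logRatio (hτ0 : 0 ≤ τ) (hτ : τ < 1) :
    StrictMonoOn (fun s => logRatio s τ) (Ioo 0 1) := by
  refine strictMonoOn_of_deriv_pos (convex_Ioo 0 1)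
    (fun s hs => (hasDerivAt_logRatio hs.1 hs.2 hτ.le).continuousAt.continuousWithinAt)
    fun s hs => ?_
  rw [interior_Ioo] at hs
  rw [(hasDerivAt_logRatio hs.1 hs.2 hτ.le).deriv]
  exact logRatioDeriv_pos hs.1 hs.2 hτ0 hτ

/-- Concavity of log on the segment from 1 to 1 - s. It yields the lower bound on `oddDrop`, linear
in 1 - τ, behind every domination for the odd waves. -/
theorem mul_logRatio_zero_le (hs0 : 0 < s) (hs1 : s < 1) (hτ0 : 0 ≤ τ) (hτ : τ ≤ 1) :
    (1 - τ) * logRatio s 0 ≤ logRatio s τ := by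
  have h := strictConcaveOn_log_Ioi.concaveOn.2 (mem_Ioi.2 one_pos)
    (mem_Ioi.2 (show 0 < 1 - s by linarith)) (show 0 ≤ 1 - τ by linarith) hτ0 (by ring)
  simp only [smul_eq_mul, Real.log_one, mul_zero, zero_add] at h
  rw [show (1 - τ) * 1 + τ * (1 - s) = 1 - τ * s by ring] at h
  unfold logRatio
  rw [← mul_div_assoc]
  gcongr
  simp only [zero_mul, sub_zero, Real.log_one]
  linarith

/-- Twice the energy drop from the amplitude `√s` to `√(τ s)`, divided by `s`. -/
noncomputable def oddDrop (a s τ : ℝ) : ℝ := a * logRatio s τ - (1 - τ)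

/-- The squared amplitudes of the odd waves. -/
def oddAmplitudes (a : ℝ) : Set ℝ := {s | s ∈ Ioo (0 : ℝ) 1 ∧ 0 < oddDrop a s 0}

theorem strictMonoOn_oddDrop (ha : 0 < a) (hτ0 : 0 ≤ τ) (hτ : τ < 1) :
    StrictMonoOn (fun s => oddDrop a s τ) (Ioo 0 1) := fun _ hx _ hy hxy =>
  sub_lt_sub_right (mul_lt_mul_of_pos_left (strictMonoOn_logRatio hτ0 hτ hx hy hxy) ha) _

theorem mul_oddDrop_zero_le (ha : 0 < a) (hs0 : 0 < s) (hs1 : s < 1) (hτ0 : 0 ≤ τ) (hτ : τ ≤ 1) :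
    (1 - τ) * oddDrop a s 0 ≤ oddDrop a s τ := by
  have := mul_le_mul_of_nonneg_left (mul_logRatio_zero_le hs0 hs1 hτ0 hτ) ha.le
  unfold oddDrop
  linarith

theorem oddDrop_pos (ha : 0 < a) (hs : s ∈ oddAmplitudes a) (hτ0 : 0 ≤ τ) (hτ : τ < 1) :
    0 < oddDrop a s τ :=
  (mul_pos (sub_pos.2 hτ) hs.2).trans_le (mul_oddDrop_zero_le ha hs.1.1 hs.1.2 hτ0 hτ.le)

theorem oddAmplitudes_of_le (ha : 0 < a) (hs : s ∈ oddAmplitudes a) {r : ℝ} (hsr : s ≤ r)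
    (hr : r < 1) : r ∈ oddAmplitudes a := by
  have hr1 : r ∈ Ioo (0 : ℝ) 1 := ⟨hs.1.1.trans_le hsr, hr⟩
  exact ⟨hr1, hs.2.trans_le
    ((strictMonoOn_oddDrop ha le_rfl one_pos).monotoneOn hs.1 hr1 hsr)⟩

theorem hasDerivAt_oddDrop (a : ℝ) (hs0 : 0 < s) (hs1 : s < 1) (hτ : τ ≤ 1) :
    HasDerivAt (fun s => oddDrop a s τ) (a * logRatioDeriv s τ) s :=
  ((hasDerivAt_logRatio hs0 hs1 hτ).const_mul a).sub_const _

theorem isOpen_oddAmplitudes (a : ℝ) : IsOpen (oddAmplitudes a) := by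
  have hc : ContinuousOn (fun s => oddDrop a s 0) (Ioo 0 1) := fun s hs =>
    (hasDerivAt_oddDrop a hs.1 hs.2 zero_le_one).continuousAt.continuousWithinAt
  exact hc.isOpen_inter_preimage isOpen_Ioo (isOpen_Ioi (a := (0 : ℝ)))

end LogRatio

/-! ### The period integral of the odd waves as a function of the squared amplitude -/

section OddIntegral

variable {a : ℝ}

theorem sq_lt_one_of_mem {t : ℝ} (ht : t ∈ Ioo (-1 : ℝ) 1) : t ^ 2 < 1 := by
  nlinarith [ht.1, ht.2]

theorem one_div_sqrt_oddDrop_le (ha : 0 < a) {s : ℝ} (hs : s ∈ oddAmplitudes a) {t : ℝ}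
    (ht : t ∈ Ioo (-1 : ℝ) 1) :
    1 / √(oddDrop a s (t ^ 2)) ≤ 1 / √(oddDrop a s 0) * (1 / √(1 - t ^ 2)) := by
  have h1 : 0 < 1 - t ^ 2 := sub_pos.2 (sq_lt_one_of_mem ht)
  have h := mul_oddDrop_zero_le ha hs.1.1 hs.1.2 (sq_nonneg t) (sq_lt_one_of_mem ht).le
  have hp := Real.sqrt_pos.2 h1
  have hq := Real.sqrt_pos.2 hs.2
  rw [one_div_mul_one_div, mul_comm, ← Real.sqrt_mul h1.le]
  have := Real.sqrt_pos.2 (mul_pos h1 hs.2)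
  gcongr

theorem measurable_oddDrop (a s : ℝ) : Measurable fun t : ℝ => oddDrop a s (t ^ 2) := by
  unfold oddDrop logRatio
  fun_prop

theorem measurable_logRatioDeriv (s : ℝ) : Measurable fun t : ℝ => logRatioDeriv s (t ^ 2) := by
  unfold logRatioDeriv
  fun_prop

theorem integrableOn_one_div_sqrt_oddDrop (ha : 0 < a) {s : ℝ} (hs : s ∈ oddAmplitudes a) :
    IntegrableOn (fun t => 1 / √(oddDrop a s (t ^ 2))) (Ioo (-1) 1) := by
  refine Integrable.mono' (integrableOn_one_div_sqrt_one_sub_sq.integrable.const_mul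
    (1 / √(oddDrop a s 0)))
    (measurable_const.div (measurable_oddDrop a s).sqrt).aestronglyMeasurable ?_
  filter_upwards [ae_restrict_mem measurableSet_Ioo] with t ht
  rw [Real.norm_of_nonneg (by positivity)]
  exact one_div_sqrt_oddDrop_le ha hs ht

theorem contDiffOn_integral_oddDrop (ha : 0 < a) :
    ContDiffOn ℝ 1 (fun s => ∫ t in Ioo (-1) 1, 1 / √(oddDrop a s (t ^ 2)))
      (oddAmplitudes a) := by
  refine contDiffOn_integral_of_dominated (F' := fun s t =>
      -(a * logRatioDeriv s (t ^ 2) / (2 * √(oddDrop a s (t ^ 2)))) /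
        √(oddDrop a s (t ^ 2)) ^ 2) (isOpen_oddAmplitudes a)
    (fun s hs => integrableOn_one_div_sqrt_oddDrop ha hs) (fun s _ => ?_) ?_ ?_ (fun s₀ hs₀ => ?_)
  · refine Measurable.aestronglyMeasurable ?_
    have h1 := measurable_oddDrop a s
    have h2 := measurable_logRatioDeriv s
    fun_prop
  · filter_upwards [ae_restrict_mem measurableSet_Ioo] with t ht s hs
    have hpos := oddDrop_pos ha hs (sq_nonneg t) (sq_lt_one_of_mem ht)
    simpa only [one_div] using ((hasDerivAt_oddDrop a hs.1.1 hs.1.2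
      (sq_lt_one_of_mem ht).le).sqrt hpos.ne').fun_inv (Real.sqrt_pos.2 hpos).ne'
  · filter_upwards [ae_restrict_mem measurableSet_Ioo] with t ht s hs
    have hpos := Real.sqrt_pos.2 (oddDrop_pos ha hs (sq_nonneg t) (sq_lt_one_of_mem ht))
    have hG : ContinuousAt (fun s => oddDrop a s (t ^ 2)) s :=
      (hasDerivAt_oddDrop a hs.1.1 hs.1.2 (sq_lt_one_of_mem ht).le).continuousAt
    have hD : ContinuousAt (fun s => logRatioDeriv s (t ^ 2)) s := by
      have h0 : s ≠ 0 := hs.1.1.ne'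
      have h1 : 1 - s ≠ 0 := by linarith [hs.1.2]
      have h2 : 1 - t ^ 2 * s ≠ 0 := by nlinarith [hs.1.1, hs.1.2, sq_lt_one_of_mem ht]
      have h3 : (1 - s) * (1 - t ^ 2 * s) ≠ 0 := mul_ne_zero h1 h2
      have h4 : s ^ 2 ≠ 0 := pow_ne_zero 2 h0
      unfold logRatioDeriv
      fun_prop (disch := assumption)
    have h5 : 2 * √(oddDrop a s (t ^ 2)) ≠ 0 := by positivity
    have h6 : √(oddDrop a s (t ^ 2)) ^ 2 ≠ 0 := by positivity
    fun_prop (disch := assumption)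
  -- Only the left end l must be checked to be admissible: `oddAmplitudes` is closed upwards within
  -- (0, 1), and r merely has to stay below 1.
  · obtain ⟨ε, hε, hball⟩ := Metric.isOpen_iff.1 (isOpen_oddAmplitudes a) s₀ hs₀
    have hs1 : s₀ - ε / 2 ∈ oddAmplitudes a := hball (by
      rw [Metric.mem_ball, Real.dist_eq, sub_sub_cancel_left, abs_neg, abs_of_pos (by linarith)]
      linarith)
    set l := s₀ - ε / 2 with hl
    set r := (s₀ + 1) / 2 with hr
    have hr1 : r < 1 := by linarith [hs₀.1.2]
    refine ⟨fun t => a / (l * (1 - r) ^ 2) / (2 * √(oddDrop a l 0) ^ 3) * (1 / √(1 - t ^ 2)),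
      integrableOn_one_div_sqrt_one_sub_sq.integrable.const_mul _, Ioo l r,
      isOpen_Ioo.mem_nhds ⟨by linarith, by linarith [hs₀.1.2]⟩, ?_⟩
    filter_upwards [ae_restrict_mem measurableSet_Ioo] with t ht s hs
    have ht1 := sq_lt_one_of_mem ht
    have hl0 := hs1.1.1
    have hsA := oddAmplitudes_of_le ha hs1 hs.1.le (hs.2.trans hr1)
    have hτ : 0 < 1 - t ^ 2 := sub_pos.2 ht1
    have hp := logRatioDeriv_pos hsA.1.1 hsA.1.2 (sq_nonneg t) ht1
    have hle := logRatioDeriv_le hsA.1.1 hsA.1.2 ht1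
    have hle' : logRatioDeriv s (t ^ 2) ≤ (1 - t ^ 2) / (l * (1 - r) ^ 2) := by
      refine hle.trans ?_
      have h1 : 0 < 1 - r := by linarith
      have h2 := hs.1
      have h3 := hs.2
      have h4 := hsA.1.1.le
      gcongr
    have hG : (1 - t ^ 2) * oddDrop a l 0 ≤ oddDrop a s (t ^ 2) :=
      (mul_le_mul_of_nonneg_left ((strictMonoOn_oddDrop ha le_rfl one_pos).monotoneOn hs1.1
        hsA.1 hs.1.le) hτ.le).trans
        (mul_oddDrop_zero_le ha hsA.1.1 hsA.1.2 (sq_nonneg t) ht1.le)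
    have hsG : √(1 - t ^ 2) * √(oddDrop a l 0) ≤ √(oddDrop a s (t ^ 2)) := by
      rw [← Real.sqrt_mul hτ.le]
      exact Real.sqrt_le_sqrt hG
    have hq1 := Real.sqrt_pos.2 hτ
    have hq2 := Real.sqrt_pos.2 hs1.2
    have hq3 := (mul_pos hq1 hq2).trans_le hsG
    have hq4 : √(1 - t ^ 2) ^ 2 = 1 - t ^ 2 := Real.sq_sqrt hτ.le
    have h1r : 0 < 1 - r := by linarith
    calc |-(a * logRatioDeriv s (t ^ 2) / (2 * √(oddDrop a s (t ^ 2)))) /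
            √(oddDrop a s (t ^ 2)) ^ 2|
        = a * logRatioDeriv s (t ^ 2) / (2 * √(oddDrop a s (t ^ 2)) ^ 3) := by
          rw [neg_div, abs_neg, abs_of_nonneg (by positivity)]
          field_simp
      _ ≤ a * ((1 - t ^ 2) / (l * (1 - r) ^ 2)) /
            (2 * (√(1 - t ^ 2) * √(oddDrop a l 0)) ^ 3) := by gcongr
      _ = a / (l * (1 - r) ^ 2) / (2 * √(oddDrop a l 0) ^ 3) * (1 / √(1 - t ^ 2)) := by
          rw [← hq4]
          field_simp
          rw [Real.sqrt_sq hq1.le]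

end OddIntegral

/-! ### Odd waves: amplitude, energy and period -/

section Odd

variable {ω s : ℝ}

/-- The potential as a function of the squared amplitude. -/
noncomputable def oddEnergy (ω s : ℝ) : ℝ :=
  criticalEnergy ω + 1 / 2 * (-s - (1 - ω) * Real.log (1 - s))

theorem potential_eq_oddEnergy (hω : ω < 1) {φ : ℝ} (h : φ ^ 2 < 1) :
    potential ω φ = oddEnergy ω (φ ^ 2) := by
  have h1 : 1 - ω ≠ 0 := by linarith
  have h2 : 1 - φ ^ 2 ≠ 0 := by linarith
  rw [oddEnergy, criticalEnergy_eq, potential, potential, Real.log_div h1 h2]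
  norm_num
  ring

/-- With φ = √s t and τ = t², the factor s cancels the Jacobian √s after taking the root. -/
theorem oddEnergy_sub (hs : s ≠ 0) (τ : ℝ) :
    2 * (oddEnergy ω s - oddEnergy ω (τ * s)) = s * oddDrop (1 - ω) s τ := by
  unfold oddEnergy oddDrop logRatio
  field_simp
  ring

/-- Only the larger argument has to be admissible. For 0 < ω the energy first dips below the
critical level as the amplitude grows, so it is not monotone on all of (0, 1). -/
theorem oddEnergy_lt (hω : ω < 1) (hs : s ∈ oddAmplitudes (1 - ω)) {r : ℝ} (hr : 0 ≤ r)
    (hrs : r < s) : oddEnergy ω r < oddEnergy ω s := by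
  have h := oddEnergy_sub (ω := ω) hs.1.1.ne' (r / s)
  rw [div_mul_cancel₀ _ hs.1.1.ne'] at h
  have := mul_pos hs.1.1 (oddDrop_pos (sub_pos.2 hω) hs (div_nonneg hr hs.1.1.le)
    ((div_lt_one hs.1.1).2 hrs))
  linarith

theorem injOn_oddEnergy (hω : ω < 1) : InjOn (oddEnergy ω) (oddAmplitudes (1 - ω)) :=
  StrictMonoOn.injOn fun _ hx _ hy hxy => oddEnergy_lt hω hy hx.1.1.le hxy

theorem criticalEnergy_lt_oddEnergy (hω : ω < 1) (hs : s ∈ oddAmplitudes (1 - ω)) :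
    criticalEnergy ω < oddEnergy ω s := by
  have := oddEnergy_lt hω hs le_rfl hs.1.1
  simpa [oddEnergy] using this

theorem exists_oddEnergy_eq (hω : ω < 1) {𝓔 : ℝ} (h𝓔 : criticalEnergy ω < 𝓔) :
    ∃ s ∈ oddAmplitudes (1 - ω), oddEnergy ω s = 𝓔 := by
  have ha : 0 < 1 - ω := by linarith
  -- Chosen so that -(1-ω) log (1-r) = 2(𝓔 - `criticalEnergy` ω) + 1; the extra 1 outweighs the term
  -- -r in `oddEnergy`.
  set c := (2 * (𝓔 - criticalEnergy ω) + 1) / (1 - ω) with hc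
  have hc0 : 0 < c := div_pos (by linarith) ha
  set r := 1 - Real.exp (-c) with hr
  have hr1 : r < 1 := by linarith [Real.exp_pos (-c)]
  have hr0 : 0 < r := by
    have : Real.exp (-c) < 1 := by rwa [Real.exp_lt_one_iff, neg_lt_zero]
    linarith
  have hcont : ContinuousOn (oddEnergy ω) (Icc 0 r) := by
    have : ∀ x ∈ Icc 0 r, 1 - x ≠ 0 := fun x hx => by linarith [hx.2]
    unfold oddEnergy
    fun_prop (disch := assumption)
  have hEr : 𝓔 ≤ oddEnergy ω r := by
    have h1 : (1 - ω) * c = 2 * (𝓔 - criticalEnergy ω) + 1 := mul_div_cancel₀ _ ha.ne'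
    rw [oddEnergy, show 1 - r = Real.exp (-c) by rw [hr]; ring, Real.log_exp]
    linarith
  have h0 : oddEnergy ω 0 = criticalEnergy ω := by simp [oddEnergy]
  obtain ⟨s, hs, hsE⟩ := intermediate_value_Icc hr0.le hcont
    (show 𝓔 ∈ Icc _ _ from ⟨by rw [h0]; exact h𝓔.le, hEr⟩)
  have hs0 : 0 < s := by
    refine lt_of_le_of_ne hs.1 ?_
    rintro rfl
    rw [h0] at hsE
    exact h𝓔.ne hsE
  refine ⟨s, ⟨⟨hs0, hs.2.trans_lt hr1⟩, ?_⟩, hsE⟩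
  have h := oddEnergy_sub (ω := ω) hs0.ne' 0
  rw [zero_mul, h0, hsE] at h
  exact pos_of_mul_pos_right (h ▸ by linarith) hs0.le

theorem orbitRange_oddEnergy (hω : ω < 1) (hs : s ∈ oddAmplitudes (1 - ω)) :
    orbitRange ω (oddEnergy ω s) = Icc (-√s) √s := by
  have hs0 := hs.1.1
  have hs1 := hs.1.2
  have hcrit := criticalEnergy_lt_oddEnergy hω hs
  ext φ
  rw [mem_orbitRange, mem_Icc, ← abs_le, Real.le_sqrt (abs_nonneg φ) hs0.le, sq_abs]
  constructor
  · rintro ⟨h1, h2, h3, -⟩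
    have hsq : φ ^ 2 < 1 := by nlinarith
    rw [potential_eq_oddEnergy hω hsq] at h3
    by_contra! h
    exact h3.not_gt (oddEnergy_lt hω (oddAmplitudes_of_le (sub_pos.2 hω) hs h.le hsq) hs0.le h)
  · intro h
    have hsq : φ ^ 2 < 1 := h.trans_lt hs1
    have habs := abs_lt.1 ((sq_lt_one_iff_abs_lt_one φ).1 hsq)
    refine ⟨habs.1, habs.2, ?_, fun hlt => absurd hlt hcrit.not_gt⟩
    rw [potential_eq_oddEnergy hω hsq]
    rcases h.lt_or_eq with h | h
    · exact (oddEnergy_lt hω hs (sq_nonneg φ) h).le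
    · rw [h]

theorem image_mul_sqrt (hs : 0 < s) : (fun t => √s * t) '' Ioo (-1) 1 = Ioo (-√s) √s := by
  rw [image_mul_left_Ioo (Real.sqrt_pos.2 hs)]
  simp

theorem orbitRange_oddEnergy_ae_eq (hω : ω < 1) (hs : s ∈ oddAmplitudes (1 - ω)) :
    orbitRange ω (oddEnergy ω s) =ᵐ[volume] (fun t => √s * t) '' Ioo (-1) 1 := by
  rw [orbitRange_oddEnergy hω hs, image_mul_sqrt hs.1.1]
  exact Ioo_ae_eq_Icc.symm

theorem abs_sqrt_smul_periodIntegrand (hω : ω < 1) (hs : s ∈ oddAmplitudes (1 - ω)) {t : ℝ}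
    (ht : t ∈ Ioo (-1 : ℝ) 1) :
    |√s| • periodIntegrand ω (oddEnergy ω s) (√s * t) =
      1 / √(oddDrop (1 - ω) s (t ^ 2)) := by
  have hs0 := hs.1.1
  have hsq : (√s * t) ^ 2 = t ^ 2 * s := by rw [mul_pow, Real.sq_sqrt hs0.le, mul_comm]
  have hlt : (√s * t) ^ 2 < 1 := by
    rw [hsq]
    nlinarith [sq_lt_one_of_mem ht, hs.1.2]
  have hp := Real.sqrt_pos.2 hs0
  have hq := Real.sqrt_pos.2
    (oddDrop_pos (sub_pos.2 hω) hs (sq_nonneg t) (sq_lt_one_of_mem ht))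
  rw [periodIntegrand, potential_eq_oddEnergy hω hlt, hsq, oddEnergy_sub hs0.ne',
    Real.sqrt_mul hs0.le, abs_of_pos hp, smul_eq_mul]
  field_simp

theorem hasDerivWithinAt_sqrt_mul (s : ℝ) :
    ∀ t ∈ Ioo (-1 : ℝ) 1, HasDerivWithinAt (fun t => √s * t) √s (Ioo (-1) 1) t := fun t _ => by
  simpa using ((hasDerivAt_id t).const_mul √s).hasDerivWithinAt

theorem integrableOn_orbitRange_odd (hω : ω < 1) (hs : s ∈ oddAmplitudes (1 - ω)) :
    IntegrableOn (periodIntegrand ω (oddEnergy ω s)) (orbitRange ω (oddEnergy ω s)) := by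
  refine IntegrableOn.congr_set_ae ?_ (orbitRange_oddEnergy_ae_eq hω hs)
  rw [integrableOn_image_iff_integrableOn_abs_deriv_smul measurableSet_Ioo
    (hasDerivWithinAt_sqrt_mul s) (mul_right_injective₀ (Real.sqrt_pos.2 hs.1.1).ne').injOn]
  exact (integrableOn_one_div_sqrt_oddDrop (sub_pos.2 hω) hs).congr_fun
    (fun t ht => (abs_sqrt_smul_periodIntegrand hω hs ht).symm) measurableSet_Ioo

theorem period_odd (hω : ω < 1) (hs : s ∈ oddAmplitudes (1 - ω)) :
    period (oddEnergy ω s) ω =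
      2 * ∫ t in Ioo (-1) 1, 1 / √(oddDrop (1 - ω) s (t ^ 2)) := by
  rw [period, setIntegral_congr_set (orbitRange_oddEnergy_ae_eq hω hs),
    integral_image_eq_integral_abs_deriv_smul measurableSet_Ioo
    (hasDerivWithinAt_sqrt_mul s) (mul_right_injective₀ (Real.sqrt_pos.2 hs.1.1).ne').injOn,
    setIntegral_congr_fun measurableSet_Ioo
      fun t ht => abs_sqrt_smul_periodIntegrand hω hs ht]

/-- The squared amplitude of the odd wave of given energy. -/
noncomputable def oddAmplitudeSq (ω : ℝ) : ℝ → ℝ :=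
  Function.invFunOn (oddEnergy ω) (oddAmplitudes (1 - ω))

theorem oddAmplitudeSq_mem (hω : ω < 1) {𝓔 : ℝ} (h𝓔 : criticalEnergy ω < 𝓔) :
    oddAmplitudeSq ω 𝓔 ∈ oddAmplitudes (1 - ω) :=
  Function.invFunOn_mem (exists_oddEnergy_eq hω h𝓔)

theorem oddEnergy_oddAmplitudeSq (hω : ω < 1) {𝓔 : ℝ} (h𝓔 : criticalEnergy ω < 𝓔) :
    oddEnergy ω (oddAmplitudeSq ω 𝓔) = 𝓔 :=
  Function.invFunOn_eq (exists_oddEnergy_eq hω h𝓔)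

theorem hasStrictDerivAt_oddEnergy (hs : s < 1) :
    HasStrictDerivAt (oddEnergy ω) (1 / 2 * ((1 - ω) / (1 - s) - 1)) s := by
  have h1 : 1 - s ≠ 0 := by linarith
  refine ((((hasStrictDerivAt_id s).neg.sub ((((hasStrictDerivAt_id s).const_sub 1).log
    h1).const_mul (1 - ω))).const_mul (1 / 2)).const_add (criticalEnergy ω)).congr_deriv ?_
  simp only [id]
  ring

/-- Admissibility says (1-ω)(-log (1-s))/s > 1, and -log (1-s)/s ≤ 1/(1-s). -/
theorem oddEnergy_deriv_pos (hω : ω < 1) (hs : s ∈ oddAmplitudes (1 - ω)) :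
    0 < 1 / 2 * ((1 - ω) / (1 - s) - 1) := by
  have hs0 := hs.1.1
  have h1 : 0 < 1 - s := by linarith [hs.1.2]
  have ha : 0 < 1 - ω := by linarith
  have hd := hs.2
  have hlog := Real.one_sub_inv_le_log_of_pos h1
  have h2 : -Real.log (1 - s) / s ≤ 1 / (1 - s) := by
    rw [div_le_iff₀ hs0]
    have : 1 / (1 - s) * s = -(1 - (1 - s)⁻¹) := by
      field_simp
      ring
    rw [this]
    linarith
  have h3 := mul_le_mul_of_nonneg_left h2 ha.le
  simp only [oddDrop, logRatio, zero_mul, sub_zero, Real.log_one, zero_sub] at hd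
  rw [mul_one_div] at h3
  linarith

theorem contDiffOn_oddAmplitudeSq (hω : ω < 1) :
    ContDiffOn ℝ 1 (oddAmplitudeSq ω) (Ioi (criticalEnergy ω)) := by
  have hd : ∀ 𝓔 ∈ Ioi (criticalEnergy ω), HasDerivAt (oddAmplitudeSq ω)
      (1 / 2 * ((1 - ω) / (1 - oddAmplitudeSq ω 𝓔) - 1))⁻¹ 𝓔 := fun 𝓔 h𝓔 => by
    have hs := oddAmplitudeSq_mem hω h𝓔
    have h := hasStrictDerivAt_invFunOn (isOpen_oddAmplitudes _) (injOn_oddEnergy hω) hs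
      (hasStrictDerivAt_oddEnergy hs.1.2) (oddEnergy_deriv_pos hω hs).ne'
    rw [oddEnergy_oddAmplitudeSq hω h𝓔] at h
    exact h.hasDerivAt
  refine contDiffOn_one_of_hasDerivAt isOpen_Ioi hd fun 𝓔 h𝓔 => ContinuousAt.continuousWithinAt ?_
  have hs := oddAmplitudeSq_mem hω h𝓔
  have hc : ContinuousAt (oddAmplitudeSq ω) 𝓔 := (hd 𝓔 h𝓔).continuousAt
  have h1 : 1 - oddAmplitudeSq ω 𝓔 ≠ 0 := by linarith [hs.1.2]
  have h2 := (oddEnergy_deriv_pos hω hs).ne'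
  fun_prop (disch := assumption)

theorem contDiffOn_period_odd (hω : ω < 1) :
    ContDiffOn ℝ 1 (fun 𝓔 => period 𝓔 ω) (Ioi (criticalEnergy ω)) := by
  have h := ((contDiffOn_integral_oddDrop (sub_pos.2 hω)).const_smul (2 : ℝ)).comp
    (contDiffOn_oddAmplitudeSq hω) fun 𝓔 h𝓔 => oddAmplitudeSq_mem hω h𝓔
  refine h.congr fun 𝓔 h𝓔 => ?_
  have := period_odd hω (oddAmplitudeSq_mem hω h𝓔)
  rwa [oddEnergy_oddAmplitudeSq hω h𝓔] at this

theorem strictAntiOn_period_odd (hω : ω < 1) :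
    StrictAntiOn (fun 𝓔 => period 𝓔 ω) (Ioi (criticalEnergy ω)) := by
  intro x hx y hy hxy
  have ha : 0 < 1 - ω := by linarith
  obtain ⟨s, hs, rfl⟩ := exists_oddEnergy_eq hω hx
  obtain ⟨r, hr, rfl⟩ := exists_oddEnergy_eq hω hy
  have hsr : s < r := by
    by_contra! h
    rcases h.lt_or_eq with h | h
    · exact hxy.not_gt (oddEnergy_lt hω hs hr.1.1.le h)
    · exact hxy.ne (by rw [h])
  simp only
  rw [period_odd hω hs, period_odd hω hr]
  refine mul_lt_mul_of_pos_left (setIntegral_Ioo_lt (by norm_num)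
    (integrableOn_one_div_sqrt_oddDrop ha hr) (integrableOn_one_div_sqrt_oddDrop ha hs)
    fun t ht => ?_) two_pos
  have hpos := oddDrop_pos ha hs (sq_nonneg t) (sq_lt_one_of_mem ht)
  exact one_div_lt_one_div_of_lt (Real.sqrt_pos.2 hpos) (Real.sqrt_lt_sqrt hpos.le
    (strictMonoOn_oddDrop ha (sq_nonneg t) (sq_lt_one_of_mem ht) hs.1 hr.1 hsr))

end Odd

end NLSIDD

theorem theorem2 :
    -- the integral that defines the period converges
    (∀ ω : ℝ, 0 < ω → ω < 1 → ∀ 𝓔 : ℝ, 0 < 𝓔 → 𝓔 < NLSIDD.criticalEnergy ω →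
      MeasureTheory.IntegrableOn (NLSIDD.periodIntegrand ω 𝓔) (NLSIDD.orbitRange ω 𝓔)) ∧
    (∀ ω : ℝ, ω < 1 → ∀ 𝓔 : ℝ, NLSIDD.criticalEnergy ω < 𝓔 →
      MeasureTheory.IntegrableOn (NLSIDD.periodIntegrand ω 𝓔) (NLSIDD.orbitRange ω 𝓔)) ∧
    -- smoothness
    (∀ ω : ℝ, 0 < ω → ω < 1 →
      ContDiffOn ℝ 1 (fun 𝓔 : ℝ => NLSIDD.period 𝓔 ω)
        (Set.Ioi 0 \ {NLSIDD.criticalEnergy ω})) ∧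
    (∀ ω : ℝ, ω < 0 →
      ContDiffOn ℝ 1 (fun 𝓔 : ℝ => NLSIDD.period 𝓔 ω)
        (Set.Ioi (NLSIDD.criticalEnergy ω))) ∧
    -- monotonicity for the even waves
    (∀ ω : ℝ, 0 < ω → ω < 1 →
      StrictMonoOn (fun 𝓔 : ℝ => NLSIDD.period 𝓔 ω)
        (Set.Ioo 0 (NLSIDD.criticalEnergy ω))) ∧
    -- monotonicity for the odd waves
    (∀ ω : ℝ, ω < 1 →
      StrictAntiOn (fun 𝓔 : ℝ => NLSIDD.period 𝓔 ω)
        (Set.Ioi (NLSIDD.criticalEnergy ω))) := by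
  refine ⟨fun ω h0 hω 𝓔 h𝓔 hcrit => ?_, fun ω hω 𝓔 h𝓔 => ?_, fun ω h0 hω => ?_,
    fun ω hω => NLSIDD.contDiffOn_period_odd (by linarith),
    fun ω h0 hω => NLSIDD.strictMonoOn_period_even h0 hω,
    fun ω hω => NLSIDD.strictAntiOn_period_odd hω⟩
  · have ha : 0 < (1 - ω) / 2 := by linarith
    obtain ⟨k, rfl⟩ : ∃ k, 𝓔 = (1 - ω) / 2 * k :=
      ⟨𝓔 / ((1 - ω) / 2), (mul_div_cancel₀ _ ha.ne').symm⟩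
    exact NLSIDD.integrableOn_orbitRange_even h0 hω
      ⟨pos_of_mul_pos_right h𝓔 ha.le, (NLSIDD.lt_criticalEnergy_iff hω).1 hcrit⟩
  · obtain ⟨s, hs, rfl⟩ := NLSIDD.exists_oddEnergy_eq hω h𝓔
    exact NLSIDD.integrableOn_orbitRange_odd hω hs
  · rintro 𝓔 ⟨h𝓔, hne⟩
    rcases lt_or_gt_of_ne hne with h | h
    · exact ((NLSIDD.contDiffOn_period_even h0 hω).contDiffAt
        (isOpen_Ioo.mem_nhds ⟨h𝓔, h⟩)).contDiffWithinAt
    · exact ((NLSIDD.contDiffOn_period_odd hω).contDiffAt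
        (isOpen_Ioi.mem_nhds h)).contDiffWithinAt
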